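/- Let $\mathbb K=\mathbb R$ or $\mathbb C$, let $1\le p<\infty$ and let $p'\in(1,\infty]$ be given by $\frac1p+\frac1{p'}=1$. For a Banach space $X$ over $\mathbb K$, $B_X$ is its closed unit ball and $X'$ its topological dual. $X$ has the bounded approximation property if there is a constant $c$ such that for every compact $K\subseteq X$ and every $\varepsilon>0$ there is a bounded finite rank operator $T\colon X\to X$ with $\|T\|\le c$ and $\|Tx-x\|\le\varepsilon$ for all $x\in K$. Let $E_1,\dots,E_n,F$ be Banach spaces over $\mathbb K$. For $x_i'\in E_i'$ and $y\in F$, $x_1'\otimes\cdots\otimes x_n'\otimes y$ is the $n$-linear operator $(x_1,\dots,x_n)\mapsto x_1'(x_1)\cdots x_n'(x_n)\,y$. A continuous $n$-linear operator $A\colon E_1\times\cdots\times E_n\to F$ is $\sigma(p)$-nuclear if it has a representation $A(x_1,\dots,x_n)=\sum_{j=1}^\infty\lambda_j\,x_{1j}'(x_1)\cdots x_{nj}'(x_n)\,y_j$ for all $x_i\in E_i$, with $(\lambda_j)\in\ell_{p'}$, $x_{ij}'\in E_i'$, $y_j\in F$, such that the quantities $$w_m:=\sup_{x_i\in B_{E_i},\;y'\in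 B_{F'}}\Bigl(\sum_{j=m}^\infty|x_{1j}'(x_1)\cdots x_{nj}'(x_n)\,y'(y_j)|^p\Bigr)^{1/p}$$ satisfy $w_1<\infty$ and $\lim_{m\to\infty}w_m=0$. The space of these operators is $\mathcal L_{\sigma(p)}(E_1,\dots,E_n;F)$, with the norm $\|A\|_{\sigma(p)}:=\inf\|(\lambda_j)\|_{p'}\,w_1$, the infimum being over all such representations. A continuous $n$-linear operator $S\colon E_1'\times\cdots\times E_n'\to F'$ is quasi-$\tau(p)$-summing if there is a constant $C\ge0$ such that $$\Bigl(\sum_{j=1}^m|S(x_{1j}',\dots,x_{nj}')(y_j)|^p\Bigr)^{1/p}\le C\sup_{x_i''\in B_{E_i''},\;y'\in B_{F'}}\Bigl(\sum_{j=1}^m|x_1''(x_{1j}')\cdots x_n''(x_{nj}')\,y'(y_j)|^p\Bigr)^{1/p}$$ for all $m\in\mathbb N$, $x_{ij}'\in E_i'$ and $y_j\in F$. The space of these operators is $\mathcal L_{q\tau(p)}(E_1',\dots,E_n';F')$, with the norm $\|S\|_{q\tau(p)}$ equal to the infimum of all such constants $C$. **Theorem.** Suppose that $E_1',\dots,E_n'$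 have the bounded approximation property, and let $F$ be any Banach space. Then the Borel transform $$\mathcal B(\varphi)(x_1',\dots,x_n')(y):=\varphi(x_1'\otimes\cdots\otimes x_n'\otimes y)$$ is an isometric (linear) isomorphism from the dual of $\bigl(\mathcal L_{\sigma(p)}(E_1,\dots,E_n;F),\|\cdot\|_{\sigma(p)}\bigr)$ onto $\bigl(\mathcal L_{q\tau(p)}(E_1',\dots,E_n';F'),\|\cdot\|_{q\tau(p)}\bigr)$. In particular, in the linear case, if $E'$ has the bounded approximation property, then $[\mathcal L_{\sigma(p)}(E;F)]'=\mathcal L_{q\tau(p)}(E';F')$ isometrically, via $\mathcal B(\varphi)(x')(y)=\varphi(x'\otimes y)$. -/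

import Mathlib

open scoped ENNReal Topology

set_option maxSynthPendingDepth 3

universe u v w

noncomputable section

namespace SigmaTau

/-- A normed space `X` has the *bounded approximation property* if there is a constant `c` such
that the identity of `X` can be approximated, uniformly on every compact set, by bounded
finite rank operators of norm at most `c`. -/
def BoundedApproximationProperty (𝕜 : Type w) [RCLike 𝕜] (X : Type u) [NormedAddCommGroup X]
    [NormedSpace 𝕜 X] : Prop :=
  ∃ c : ℝ, ∀ K : Set X, IsCompact K → ∀ ε : ℝ, 0 < ε →
    ∃ T : X →L[𝕜] X, FiniteDimensional 𝕜 (LinearMap.range (T : X →ₗ[𝕜] X)) ∧ ‖T‖ ≤ c ∧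
      ∀ x ∈ K, ‖T x - x‖ ≤ ε

section Definitions

variable {𝕜 : Type w} [RCLike 𝕜] {n : ℕ} {E : Fin n → Type u} [∀ i, NormedAddCommGroup (E i)]
  [∀ i, NormedSpace 𝕜 (E i)] {F : Type v} [NormedAddCommGroup F] [NormedSpace 𝕜 F]

/-- The `n`-linear operator `x'₁ ⊗ ⋯ ⊗ x'ₙ ⊗ y`, `(x₁, …, xₙ) ↦ x'₁(x₁) ⋯ x'ₙ(xₙ) y`. -/
def elemTensor (x' : ∀ i, StrongDual 𝕜 (E i)) (y : F) : ContinuousMultilinearMap 𝕜 E F :=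
  ((ContinuousMultilinearMap.mkPiAlgebra 𝕜 (Fin n) 𝕜).compContinuousLinearMap x').smulRight y

@[simp]
theorem elemTensor_apply (x' : ∀ i, StrongDual 𝕜 (E i)) (y : F) (x : ∀ i, E i) :
    elemTensor x' y x = (∏ i, x' i (x i)) • y := by
  simp [elemTensor]

/-- The conjugate exponent `p'` of a real number `p ≥ 1`; it is `∞` for `p = 1`. -/
def conjExp (p : ℝ) : ℝ≥0∞ := (ENNReal.ofReal p).conjExponent

/-- The quantity
`sup { (∑_{j ≥ m} |x'_{1j}(x₁) ⋯ x'_{nj}(xₙ) y'(y_j)|^p)^{1/p} : xᵢ ∈ B_{Eᵢ}, y' ∈ B_{F'} }`,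
with values in `[0, ∞]`. -/
def sigmaSup (p : ℝ) (x' : ℕ → ∀ i, StrongDual 𝕜 (E i)) (y : ℕ → F) (m : ℕ) : ℝ≥0∞ :=
  ⨆ (x : ∀ i, E i) (_ : ∀ i, ‖x i‖ ≤ 1) (y' : StrongDual 𝕜 F) (_ : ‖y'‖ ≤ 1),
    (∑' j, ‖(∏ i, x' (j + m) i (x i)) * y' (y (j + m))‖ₑ ^ p) ^ (1 / p)

/-- `A = ∑_j λ_j x'_{1j} ⊗ ⋯ ⊗ x'_{nj} ⊗ y_j` is a `σ(p)`-nuclear representation of `A`. -/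
structure IsSigmaRep (p : ℝ) (A : ContinuousMultilinearMap 𝕜 E F)
    (l : lp (fun _ : ℕ => 𝕜) (conjExp p)) (x' : ℕ → ∀ i, StrongDual 𝕜 (E i)) (y : ℕ → F) :
    Prop where
  tendsto_sum : ∀ x : ∀ i, E i,
    Filter.Tendsto (fun N => ∑ j ∈ Finset.range N, l j • elemTensor (x' j) (y j) x)
      Filter.atTop (𝓝 (A x))
  sup_lt_top : sigmaSup p x' y 0 < ⊤
  tendsto_tail : Filter.Tendsto (fun m => sigmaSup p x' y m) Filter.atTop (𝓝 0)

/-- `A` is a `σ(p)`-nuclear `n`-linear operator. -/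
def IsSigmaNuclear (p : ℝ) (A : ContinuousMultilinearMap 𝕜 E F) : Prop :=
  ∃ l x' y, IsSigmaRep p A l x' y

/-- The `σ(p)`-nuclear norm: the infimum, over all `σ(p)`-nuclear representations of `A`, of
`‖(λ_j)‖_{p'} · sup (∑_j |x'_{1j}(x₁) ⋯ x'_{nj}(xₙ) y'(y_j)|^p)^{1/p}`. -/
def sigmaNorm (p : ℝ) (A : ContinuousMultilinearMap 𝕜 E F) : ℝ :=
  sInf {r : ℝ | ∃ l x' y, IsSigmaRep p A l x' y ∧ r = ‖l‖ * (sigmaSup p x' y 0).toReal}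

/-- The quantity
`sup { (∑_{j ≤ m} |x'₁(x_{1j}) ⋯ x'ₙ(x_{nj}) y'(y_j)|^p)^{1/p} : x'ᵢ ∈ B_{Eᵢ'}, y' ∈ B_{F'} }`. -/
def quasiTauSup (𝕜 : Type w) [RCLike 𝕜] {n : ℕ} {E : Fin n → Type u}
    [∀ i, NormedAddCommGroup (E i)] [∀ i, NormedSpace 𝕜 (E i)] {F : Type v}
    [NormedAddCommGroup F] [NormedSpace 𝕜 F] (p : ℝ) {m : ℕ} (x : Fin m → ∀ i, E i)
    (y : Fin m → F) : ℝ≥0∞ :=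
  ⨆ (x' : ∀ i, StrongDual 𝕜 (E i)) (_ : ∀ i, ‖x' i‖ ≤ 1) (y' : StrongDual 𝕜 F) (_ : ‖y'‖ ≤ 1),
    (∑ j, ‖(∏ i, x' i (x j i)) * y' (y j)‖ₑ ^ p) ^ (1 / p)

/-- `C ≥ 0` is a constant admissible in the definition of a quasi-`τ(p)`-summing operator. -/
def IsQuasiTauBound (p : ℝ) (S : ContinuousMultilinearMap 𝕜 E (StrongDual 𝕜 F)) (C : ℝ) : Prop :=
  0 ≤ C ∧ ∀ (m : ℕ) (x : Fin m → ∀ i, E i) (y : Fin m → F),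
    (∑ j, ‖S (x j) (y j)‖ₑ ^ p) ^ (1 / p) ≤ ENNReal.ofReal C * quasiTauSup 𝕜 p x y

/-- `S` is a quasi-`τ(p)`-summing `n`-linear operator. -/
def IsQuasiTau (p : ℝ) (S : ContinuousMultilinearMap 𝕜 E (StrongDual 𝕜 F)) : Prop :=
  ∃ C, IsQuasiTauBound p S C

/-- The quasi-`τ(p)`-summing norm: the infimum of all admissible constants. -/
def quasiTauNorm (p : ℝ) (S : ContinuousMultilinearMap 𝕜 E (StrongDual 𝕜 F)) : ℝ :=
  sInf {C : ℝ | IsQuasiTauBound p S C}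

/-! ### Basic facts on `σ(p)`-nuclear operators -/

theorem one_le_conjExp {p : ℝ} (hp : 1 ≤ p) : 1 ≤ conjExp p := by
  have : ENNReal.HolderConjugate (ENNReal.ofReal p) (conjExp p) :=
    ENNReal.HolderConjugate.conjExponent (by simpa using hp)
  exact this.symm.one_le

theorem conjExp_one : conjExp 1 = ⊤ := by
  simp [conjExp, ENNReal.conjExponent]

theorem holder_conjExp {p : ℝ} (hp : 1 < p) : p.HolderConjugate (conjExp p).toReal := by
  have : ENNReal.HolderConjugate (ENNReal.ofReal p) (conjExp p) :=
    ENNReal.HolderConjugate.conjExponent (by simpa using hp.le)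
  have hp0 : (ENNReal.ofReal p).toReal = p := ENNReal.toReal_ofReal (by linarith)
  have h := ENNReal.HolderConjugate.toReal (p := ENNReal.ofReal p) (q := conjExp p)
    (by rwa [hp0])
  rwa [hp0] at h

theorem sigmaSup_antitone {p : ℝ} (hp : 1 ≤ p) (x' : ℕ → ∀ i, StrongDual 𝕜 (E i)) (y : ℕ → F) :
    Antitone (sigmaSup p x' y) := by
  intro a b hab
  unfold sigmaSup
  refine iSup_mono fun x => iSup_mono fun hx => iSup_mono fun y' => iSup_mono fun hy' => ?_
  refine ENNReal.rpow_le_rpow ?_ (by positivity)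
  obtain ⟨c, rfl⟩ := Nat.exists_eq_add_of_le hab
  have := ENNReal.tsum_comp_le_tsum_of_injective (f := fun j : ℕ => j + c)
    (fun i j h => by simpa using h)
    (fun j => ‖(∏ i, x' (j + a) i (x i)) * y' (y (j + a))‖ₑ ^ p)
  refine le_trans (le_of_eq ?_) this
  refine tsum_congr fun j => ?_
  rw [show j + (a + c) = j + c + a by ring]

theorem le_sigmaSup_rpow {p : ℝ} (hp : 1 ≤ p) (x' : ℕ → ∀ i, StrongDual 𝕜 (E i)) (y : ℕ → F)
    (m : ℕ) {x : ∀ i, E i} (hx : ∀ i, ‖x i‖ ≤ 1) {y' : StrongDual 𝕜 F} (hy' : ‖y'‖ ≤ 1) :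
    ∑' j, ‖(∏ i, x' (j + m) i (x i)) * y' (y (j + m))‖ₑ ^ p ≤ sigmaSup p x' y m ^ p := by
  have hp0 : 0 < p := by linarith
  rw [← ENNReal.rpow_inv_le_iff hp0, ← one_div]
  unfold sigmaSup
  exact le_iSup_of_le x (le_iSup_of_le hx (le_iSup_of_le y' (le_iSup_of_le hy' le_rfl)))

theorem sigmaSup_le {p : ℝ} (hp : 1 ≤ p) {x' : ℕ → ∀ i, StrongDual 𝕜 (E i)} {y : ℕ → F}
    {m : ℕ} {B : ℝ≥0∞} (h : ∀ x : ∀ i, E i, (∀ i, ‖x i‖ ≤ 1) → ∀ y' : StrongDual 𝕜 F, ‖y'‖ ≤ 1 →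
      ∑' j, ‖(∏ i, x' (j + m) i (x i)) * y' (y (j + m))‖ₑ ^ p ≤ B ^ p) :
    sigmaSup p x' y m ≤ B := by
  have hp0 : 0 < p := by linarith
  unfold sigmaSup
  refine iSup_le fun x => iSup_le fun hx => iSup_le fun y' => iSup_le fun hy' => ?_
  rw [one_div, ENNReal.rpow_inv_le_iff hp0]
  exact h x hx y' hy'

theorem sigmaSup_smul {p : ℝ} (hp : 1 ≤ p) (x' : ℕ → ∀ i, StrongDual 𝕜 (E i)) (y : ℕ → F)
    (m : ℕ) (c : 𝕜) :
    sigmaSup p x' (c • y) m ≤ ‖c‖ₑ * sigmaSup p x' y m := by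
  have hp0 : 0 < p := by linarith
  refine sigmaSup_le hp fun x hx y' hy' => ?_
  rw [ENNReal.mul_rpow_of_nonneg _ _ hp0.le]
  refine le_trans (le_of_eq ?_) (mul_le_mul_right (le_sigmaSup_rpow hp x' y m hx hy') _)
  rw [← ENNReal.tsum_mul_left]
  refine tsum_congr fun j => ?_
  rw [← ENNReal.mul_rpow_of_nonneg _ _ hp0.le, ← enorm_mul]
  congr 2
  simp only [Pi.smul_apply, map_smul, smul_eq_mul]
  ring

theorem IsSigmaRep.scale {p : ℝ} (hp : 1 ≤ p) {A : ContinuousMultilinearMap 𝕜 E F}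
    {l : lp (fun _ : ℕ => 𝕜) (conjExp p)} {x' : ℕ → ∀ i, StrongDual 𝕜 (E i)} {y : ℕ → F}
    (h : IsSigmaRep p A l x' y) (c d : 𝕜) :
    IsSigmaRep p ((c * d) • A) (c • l) x' (d • y) where
  tendsto_sum x := by
    have := (h.tendsto_sum x).const_smul (c * d)
    refine this.congr fun N => ?_
    rw [Finset.smul_sum]
    refine Finset.sum_congr rfl fun j _ => ?_
    simp only [lp.coeFn_smul, Pi.smul_apply, elemTensor_apply, smul_smul, smul_eq_mul]
    congr 1
    ring
  sup_lt_top := lt_of_le_of_lt (sigmaSup_smul hp x' y 0 d)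
    (ENNReal.mul_lt_top (by simp) h.sup_lt_top)
  tendsto_tail := by
    have h1 := ENNReal.Tendsto.const_mul (a := ‖d‖ₑ) h.tendsto_tail (Or.inr (by simp))
    rw [mul_zero] at h1
    exact tendsto_of_tendsto_of_tendsto_of_le_of_le tendsto_const_nhds h1 (fun _ => zero_le)
      (fun m => sigmaSup_smul hp x' y m d)

/-- The sequence `f 0, g 0, f 1, g 1, …`. -/
def interleave {α : Type*} (f g : ℕ → α) (j : ℕ) : α :=
  if Even j then f (j / 2) else g (j / 2)

@[simp]
theorem interleave_even {α : Type*} (f g : ℕ → α) (j : ℕ) : interleave f g (2 * j) = f j := by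
  simp [interleave]

@[simp]
theorem interleave_odd {α : Type*} (f g : ℕ → α) (j : ℕ) : interleave f g (2 * j + 1) = g j := by
  have : (2 * j + 1) / 2 = j := by omega
  simp [interleave, this]

theorem sum_interleave {M : Type*} [AddCommMonoid M] (h f g : ℕ → M)
    (hf : ∀ j, h (2 * j) = f j) (hg : ∀ j, h (2 * j + 1) = g j) (N : ℕ) :
    ∑ j ∈ Finset.range N, h j =
      ∑ j ∈ Finset.range ((N + 1) / 2), f j + ∑ j ∈ Finset.range (N / 2), g j := by
  induction N with
  | zero => simp
  | succ N ih =>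
    rw [Finset.sum_range_succ, ih]
    obtain ⟨k, rfl | rfl⟩ := Nat.even_or_odd' N
    · rw [hf, show (2 * k + 1) / 2 = k by omega, show 2 * k / 2 = k by omega,
        show (2 * k + 1 + 1) / 2 = k + 1 by omega, Finset.sum_range_succ]
      abel
    · rw [hg, show (2 * k + 1) / 2 = k by omega, show (2 * k + 1 + 1) / 2 = k + 1 by omega,
        show (2 * k + 1 + 1 + 1) / 2 = k + 1 by omega, Finset.sum_range_succ _ k, add_assoc]
      rw [Finset.sum_range_succ g]

theorem memlp_interleave {p : ℝ} (hp : 1 ≤ p) (l k : lp (fun _ : ℕ => 𝕜) (conjExp p)) :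
    Memℓp (E := fun _ : ℕ => 𝕜) (interleave l k) (conjExp p) := by
  rcases hp.eq_or_lt with rfl | hp
  · have h0 : conjExp 1 ≠ 0 := by simp [conjExp_one]
    have key : ∀ q : ℝ≥0∞, q = ⊤ → ∀ f : ℕ → 𝕜, (∀ j, ‖f j‖ ≤ max ‖l‖ ‖k‖) →
        Memℓp (E := fun _ : ℕ => 𝕜) f q := by
      rintro q rfl f hf
      exact memℓp_infty ⟨max ‖l‖ ‖k‖, by rintro _ ⟨j, rfl⟩; exact hf j⟩
    refine key _ conjExp_one _ fun j => ?_
    simp only [interleave]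
    split_ifs
    · exact (lp.norm_apply_le_norm h0 l _).trans (le_max_left _ _)
    · exact (lp.norm_apply_le_norm h0 k _).trans (le_max_right _ _)
  · have hq := (holder_conjExp hp).symm.pos
    refine memℓp_gen ?_
    have h1 := lp.hasSum_norm hq l
    have h2 := lp.hasSum_norm hq k
    refine (HasSum.even_add_odd (f := fun j => ‖interleave (l : ℕ → 𝕜) k j‖ ^ (conjExp p).toReal)
      (by simpa using h1) (by simpa using h2)).summable

theorem norm_interleave_le {p : ℝ} (hp : 1 ≤ p) (l k : lp (fun _ : ℕ => 𝕜) (conjExp p))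
    {s t : ℝ} (hs : 0 < s) (ht : 0 < t) (hl : ‖l‖ ≤ s ^ (1 - 1 / p)) (hk : ‖k‖ ≤ t ^ (1 - 1 / p)) :
    ‖(⟨interleave l k, memlp_interleave hp l k⟩ : lp (fun _ : ℕ => 𝕜) (conjExp p))‖ ≤
      (s + t) ^ (1 - 1 / p) := by
  rcases hp.eq_or_lt with rfl | hp
  · have h0 : conjExp 1 ≠ 0 := by simp [conjExp_one]
    have key : ∀ q : ℝ≥0∞, q = ⊤ → ∀ f : lp (fun _ : ℕ => 𝕜) q, (∀ j, ‖f j‖ ≤ 1) → ‖f‖ ≤ 1 := by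
      rintro q rfl f hf
      exact lp.norm_le_of_forall_le zero_le_one hf
    have e : (1 : ℝ) - 1 / 1 = 0 := by norm_num
    rw [e, Real.rpow_zero] at hl hk ⊢
    refine key _ conjExp_one _ fun j => ?_
    show ‖interleave (l : ℕ → 𝕜) k j‖ ≤ 1
    simp only [interleave]
    split_ifs
    · exact (lp.norm_apply_le_norm h0 l _).trans hl
    · exact (lp.norm_apply_le_norm h0 k _).trans hk
  · have hh := holder_conjExp hp
    have hq := hh.symm.pos
    set q := (conjExp p).toReal with hqd
    have e : 1 - 1 / p = 1 / q := by
      have := hh.inv_add_inv_eq_one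
      rw [one_div, one_div]; linarith
    have h1 := lp.hasSum_norm hq l
    have h2 := lp.hasSum_norm hq k
    have h3 := (HasSum.even_add_odd (f := fun j => ‖interleave (l : ℕ → 𝕜) k j‖ ^ q)
      (by simpa using h1) (by simpa using h2))
    rw [e] at hl hk ⊢
    have aux : ∀ (f : lp (fun _ : ℕ => 𝕜) (conjExp p)) (r : ℝ), 0 < r → ‖f‖ ≤ r ^ (1 / q) →
        ‖f‖ ^ q ≤ r := by
      intro f r hr hf
      calc ‖f‖ ^ q ≤ (r ^ (1 / q)) ^ q := Real.rpow_le_rpow (lp.norm_nonneg' f) hf hq.le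
        _ = r := by rw [← Real.rpow_mul hr.le, one_div_mul_cancel hq.ne', Real.rpow_one]
    refine lp.norm_le_of_tsum_le hq (by positivity) ?_
    rw [← Real.rpow_mul (by positivity), one_div_mul_cancel hq.ne', Real.rpow_one]
    refine le_trans (le_of_eq h3.tsum_eq) ?_
    exact add_le_add (aux l s hs hl) (aux k t ht hk)

theorem sigmaSup_interleave {p : ℝ} (hp : 1 ≤ p) (x' u' : ℕ → ∀ i, StrongDual 𝕜 (E i))
    (y v : ℕ → F) (m : ℕ) :
    sigmaSup p (interleave x' u') (interleave y v) (2 * m) ≤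
      (sigmaSup p x' y m ^ p + sigmaSup p u' v m ^ p) ^ (1 / p) := by
  have hp0 : 0 < p := by linarith
  refine sigmaSup_le hp fun x hx y' hy' => ?_
  rw [← ENNReal.rpow_mul, one_div_mul_cancel hp0.ne', ENNReal.rpow_one]
  rw [← tsum_even_add_odd ENNReal.summable ENNReal.summable]
  refine add_le_add (le_trans (le_of_eq ?_) (le_sigmaSup_rpow hp x' y m hx hy'))
    (le_trans (le_of_eq ?_) (le_sigmaSup_rpow hp u' v m hx hy'))
  · refine tsum_congr fun j => ?_
    rw [show 2 * j + 2 * m = 2 * (j + m) by ring, interleave_even, interleave_even]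
  · refine tsum_congr fun j => ?_
    rw [show 2 * j + 1 + 2 * m = 2 * (j + m) + 1 by ring, interleave_odd, interleave_odd]

theorem IsSigmaRep.add {p : ℝ} (hp : 1 ≤ p) {A B : ContinuousMultilinearMap 𝕜 E F}
    {l k : lp (fun _ : ℕ => 𝕜) (conjExp p)} {x' u' : ℕ → ∀ i, StrongDual 𝕜 (E i)} {y v : ℕ → F}
    (hA : IsSigmaRep p A l x' y) (hB : IsSigmaRep p B k u' v) :
    IsSigmaRep p (A + B) ⟨interleave l k, memlp_interleave hp l k⟩
      (interleave x' u') (interleave y v) where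
  tendsto_sum x := by
    have t1 : Filter.Tendsto (fun N : ℕ => (N + 1) / 2) Filter.atTop Filter.atTop :=
      Filter.tendsto_atTop.2 fun b => Filter.eventually_atTop.2 ⟨2 * b, fun a ha => by omega⟩
    have t2 : Filter.Tendsto (fun N : ℕ => N / 2) Filter.atTop Filter.atTop :=
      Filter.tendsto_atTop.2 fun b => Filter.eventually_atTop.2 ⟨2 * b, fun a ha => by omega⟩
    refine (((hA.tendsto_sum x).comp t1).add ((hB.tendsto_sum x).comp t2)).congr fun N => ?_
    refine (sum_interleave _ _ _ (fun j => ?_) (fun j => ?_) N).symm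
    · simp only [interleave_even]
    · simp only [interleave_odd]
  sup_lt_top := by
    have hp0 : 0 < p := by linarith
    refine lt_of_le_of_lt (sigmaSup_interleave hp x' u' y v 0) ?_
    refine ENNReal.rpow_lt_top_of_nonneg (by positivity) (ENNReal.add_ne_top.2 ⟨?_, ?_⟩)
    · exact (ENNReal.rpow_lt_top_of_nonneg hp0.le hA.sup_lt_top.ne).ne
    · exact (ENNReal.rpow_lt_top_of_nonneg hp0.le hB.sup_lt_top.ne).ne
  tendsto_tail := by
    have hp0 : 0 < p := by linarith
    have t2 : Filter.Tendsto (fun N : ℕ => N / 2) Filter.atTop Filter.atTop :=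
      Filter.tendsto_atTop.2 fun b => Filter.eventually_atTop.2 ⟨2 * b, fun a ha => by omega⟩
    have h1 := (((hA.tendsto_tail.ennrpow_const p).add
      (hB.tendsto_tail.ennrpow_const p)).ennrpow_const (1 / p)).comp t2
    have e : ((0 : ℝ≥0∞) ^ p + 0 ^ p) ^ (1 / p) = 0 := by
      rw [ENNReal.zero_rpow_of_pos hp0, add_zero, ENNReal.zero_rpow_of_pos (by positivity)]
    rw [e] at h1
    refine tendsto_of_tendsto_of_tendsto_of_le_of_le tendsto_const_nhds h1 (fun _ => zero_le)
      (fun m => ?_)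
    refine le_trans (sigmaSup_antitone hp _ _ (show 2 * (m / 2) ≤ m by omega)) ?_
    exact sigmaSup_interleave hp x' u' y v (m / 2)

theorem sigmaNorm_nonneg (p : ℝ) (A : ContinuousMultilinearMap 𝕜 E F) : 0 ≤ sigmaNorm p A := by
  refine Real.sInf_nonneg ?_
  rintro r ⟨l, x', y, -, rfl⟩
  exact mul_nonneg (lp.norm_nonneg' l) ENNReal.toReal_nonneg

theorem sigmaNorm_le {p : ℝ} {A : ContinuousMultilinearMap 𝕜 E F}
    {l : lp (fun _ : ℕ => 𝕜) (conjExp p)} {x' : ℕ → ∀ i, StrongDual 𝕜 (E i)} {y : ℕ → F}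
    (h : IsSigmaRep p A l x' y) : sigmaNorm p A ≤ ‖l‖ * (sigmaSup p x' y 0).toReal := by
  refine csInf_le ⟨0, ?_⟩ ⟨l, x', y, h, rfl⟩
  rintro r ⟨l, x', y, -, rfl⟩
  exact mul_nonneg (lp.norm_nonneg' l) ENNReal.toReal_nonneg

theorem IsSigmaNuclear.exists_lt {p : ℝ} {A : ContinuousMultilinearMap 𝕜 E F}
    (h : IsSigmaNuclear p A) {s : ℝ} (hs : sigmaNorm p A < s) :
    ∃ l x' y, IsSigmaRep p A l x' y ∧ ‖l‖ * (sigmaSup p x' y 0).toReal < s := by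
  obtain ⟨l, x', y, h⟩ := h
  have hne : {r : ℝ | ∃ l x' y, IsSigmaRep p A l x' y ∧
      r = ‖l‖ * (sigmaSup p x' y 0).toReal}.Nonempty := ⟨_, l, x', y, h, rfl⟩
  obtain ⟨r, ⟨l, x', y, h, rfl⟩, hr⟩ := exists_lt_of_csInf_lt hne hs
  exact ⟨l, x', y, h, hr⟩

/-- A representation can be rescaled so that its two factors are balanced. -/
theorem IsSigmaRep.balance {p : ℝ} (hp : 1 ≤ p) {A : ContinuousMultilinearMap 𝕜 E F}
    {l : lp (fun _ : ℕ => 𝕜) (conjExp p)} {x' : ℕ → ∀ i, StrongDual 𝕜 (E i)} {y : ℕ → F}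
    (h : IsSigmaRep p A l x' y) {s : ℝ} (hs : ‖l‖ * (sigmaSup p x' y 0).toReal < s) :
    ∃ k v, IsSigmaRep p A k x' v ∧ ‖k‖ ≤ s ^ (1 - 1 / p) ∧
      sigmaSup p x' v 0 ≤ ENNReal.ofReal (s ^ (1 / p)) := by
  have hs0 : 0 < s :=
    lt_of_le_of_lt (mul_nonneg (lp.norm_nonneg' l) ENNReal.toReal_nonneg) hs
  have hq : conjExp p ≠ 0 := (zero_lt_one.trans_le (one_le_conjExp hp)).ne'
  set W := (sigmaSup p x' y 0).toReal with hW
  have hW0 : 0 ≤ W := ENNReal.toReal_nonneg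
  obtain ⟨c, hc, h1, h2⟩ : ∃ c : ℝ, 0 < c ∧ c * ‖l‖ ≤ s ^ (1 - 1 / p) ∧
      c⁻¹ * W ≤ s ^ (1 / p) := by
    rcases (lp.norm_nonneg' l).eq_or_lt with h0 | h0
    · refine ⟨(W + 1) / s ^ (1 / p), by positivity, ?_, ?_⟩
      · rw [← h0, mul_zero]; positivity
      · rw [inv_div, div_mul_eq_mul_div, div_le_iff₀ (by positivity)]
        have : 0 < s ^ (1 / p) := by positivity
        nlinarith
    · refine ⟨s ^ (1 - 1 / p) / ‖l‖, by positivity, ?_, ?_⟩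
      · rw [div_mul_cancel₀ _ h0.ne']
      · rw [inv_div, div_mul_eq_mul_div, div_le_iff₀ (by positivity), ← Real.rpow_add hs0]
        simpa using hs.le
  have hcK : (c : 𝕜) * ((c⁻¹ : ℝ) : 𝕜) = 1 := by
    rw [← RCLike.ofReal_mul, mul_inv_cancel₀ hc.ne', RCLike.ofReal_one]
  refine ⟨(c : 𝕜) • l, ((c⁻¹ : ℝ) : 𝕜) • y, ?_, ?_, ?_⟩
  · have := h.scale hp (c : 𝕜) ((c⁻¹ : ℝ) : 𝕜)
    rwa [hcK, one_smul] at this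
  · refine (lp.norm_const_smul_le hq _ _).trans ?_
    rwa [RCLike.norm_ofReal, abs_of_pos hc]
  · refine (sigmaSup_smul hp x' y 0 _).trans ?_
    rw [← ENNReal.ofReal_toReal h.sup_lt_top.ne, ← hW, ← ofReal_norm, RCLike.norm_ofReal,
      abs_of_pos (inv_pos.2 hc), ← ENNReal.ofReal_mul (inv_pos.2 hc).le]
    exact ENNReal.ofReal_le_ofReal h2

theorem IsSigmaNuclear.add {p : ℝ} (hp : 1 ≤ p) {A B : ContinuousMultilinearMap 𝕜 E F}
    (hA : IsSigmaNuclear p A) (hB : IsSigmaNuclear p B) : IsSigmaNuclear p (A + B) := by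
  obtain ⟨l, x', y, h⟩ := hA
  obtain ⟨k, u', v, h'⟩ := hB
  exact ⟨_, _, _, h.add hp h'⟩

theorem IsSigmaNuclear.smul {p : ℝ} (hp : 1 ≤ p) {A : ContinuousMultilinearMap 𝕜 E F}
    (hA : IsSigmaNuclear p A) (c : 𝕜) : IsSigmaNuclear p (c • A) := by
  obtain ⟨l, x', y, h⟩ := hA
  have := h.scale hp c 1
  rw [mul_one] at this
  exact ⟨_, _, _, this⟩

theorem sigmaNorm_add_le {p : ℝ} (hp : 1 ≤ p) {A B : ContinuousMultilinearMap 𝕜 E F}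
    (hA : IsSigmaNuclear p A) (hB : IsSigmaNuclear p B) :
    sigmaNorm p (A + B) ≤ sigmaNorm p A + sigmaNorm p B := by
  have hp0 : 0 < p := by linarith
  refine le_of_forall_pos_le_add fun ε hε => ?_
  have hs : sigmaNorm p A < sigmaNorm p A + ε / 2 := by linarith
  have ht : sigmaNorm p B < sigmaNorm p B + ε / 2 := by linarith
  set s := sigmaNorm p A + ε / 2 with hsd
  set t := sigmaNorm p B + ε / 2 with htd
  have hs0 : 0 < s := (sigmaNorm_nonneg p A).trans_lt hs
  have ht0 : 0 < t := (sigmaNorm_nonneg p B).trans_lt ht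
  obtain ⟨l, x', y, h, hlt⟩ := hA.exists_lt hs
  obtain ⟨k, u', v, h', hlt'⟩ := hB.exists_lt ht
  obtain ⟨l, y, h, hl, hy⟩ := h.balance hp hlt
  obtain ⟨k, v, h', hk, hv⟩ := h'.balance hp hlt'
  have h1 := norm_interleave_le hp l k hs0 ht0 hl hk
  have aux : ∀ (r : ℝ) (_ : 0 < r) (W : ℝ≥0∞), W ≤ ENNReal.ofReal (r ^ (1 / p)) →
      W ^ p ≤ ENNReal.ofReal r := by
    intro r hr W hW
    refine (ENNReal.rpow_le_rpow hW hp0.le).trans (le_of_eq ?_)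
    rw [ENNReal.ofReal_rpow_of_nonneg (by positivity) hp0.le, ← Real.rpow_mul hr.le,
      one_div_mul_cancel hp0.ne', Real.rpow_one]
  have h2 : sigmaSup p (interleave x' u') (interleave y v) 0 ≤
      ENNReal.ofReal ((s + t) ^ (1 / p)) := by
    refine (sigmaSup_interleave hp x' u' y v 0).trans ?_
    rw [← ENNReal.ofReal_rpow_of_nonneg (by positivity) (by positivity),
      ENNReal.ofReal_add hs0.le ht0.le]
    exact ENNReal.rpow_le_rpow (add_le_add (aux s hs0 _ hy) (aux t ht0 _ hv)) (by positivity)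
  refine (sigmaNorm_le (h.add hp h')).trans ?_
  calc _ ≤ (s + t) ^ (1 - 1 / p) * (s + t) ^ (1 / p) :=
        mul_le_mul h1 (ENNReal.toReal_le_of_le_ofReal (by positivity) h2) ENNReal.toReal_nonneg
          (by positivity)
    _ = s + t := by rw [← Real.rpow_add (by positivity)]; simp
    _ = _ := by rw [hsd, htd]; ring

theorem sigmaNorm_smul_le {p : ℝ} (hp : 1 ≤ p) {A : ContinuousMultilinearMap 𝕜 E F}
    (hA : IsSigmaNuclear p A) (c : 𝕜) : sigmaNorm p (c • A) ≤ ‖c‖ * sigmaNorm p A := by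
  have hq : conjExp p ≠ 0 := (zero_lt_one.trans_le (one_le_conjExp hp)).ne'
  have key : ∀ s, sigmaNorm p A < s → sigmaNorm p (c • A) ≤ ‖c‖ * s := by
    intro s hs
    obtain ⟨l, x', y, h, hlt⟩ := hA.exists_lt hs
    have h1 := h.scale hp c 1
    rw [mul_one, one_smul] at h1
    refine (sigmaNorm_le h1).trans ?_
    calc _ ≤ (‖c‖ * ‖l‖) * (sigmaSup p x' y 0).toReal :=
          mul_le_mul_of_nonneg_right (lp.norm_const_smul_le hq c l) ENNReal.toReal_nonneg
      _ = ‖c‖ * (‖l‖ * (sigmaSup p x' y 0).toReal) := by ring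
      _ ≤ ‖c‖ * s := mul_le_mul_of_nonneg_left hlt.le (norm_nonneg c)
  refine le_of_tendsto_of_tendsto (f := fun _ : ℝ => sigmaNorm p (c • A))
    (g := fun s => ‖c‖ * s) (b := 𝓝[>] (sigmaNorm p A)) tendsto_const_nhds
    (((continuous_const_mul ‖c‖).tendsto _).mono_left nhdsWithin_le_nhds) ?_
  filter_upwards [self_mem_nhdsWithin] with s hs using key s hs

theorem sum_norm_mul_le {p : ℝ} (hp : 1 ≤ p) (l : lp (fun _ : ℕ => 𝕜) (conjExp p)) (g : ℕ → 𝕜)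
    {W : ℝ} (hW : 0 ≤ W) (hg : ∀ N, ∑ j ∈ Finset.range N, ‖g j‖ ^ p ≤ W ^ p) (N : ℕ) :
    ∑ j ∈ Finset.range N, ‖l j‖ * ‖g j‖ ≤ ‖l‖ * W := by
  rcases hp.eq_or_lt with rfl | hp
  · have h0 : conjExp 1 ≠ 0 := by simp [conjExp_one]
    simp only [Real.rpow_one] at hg
    calc ∑ j ∈ Finset.range N, ‖l j‖ * ‖g j‖ ≤ ∑ j ∈ Finset.range N, ‖l‖ * ‖g j‖ := by
          gcongr with j hj
          exact lp.norm_apply_le_norm h0 l j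
      _ = ‖l‖ * ∑ j ∈ Finset.range N, ‖g j‖ := by rw [Finset.mul_sum]
      _ ≤ ‖l‖ * W := mul_le_mul_of_nonneg_left (hg N) (lp.norm_nonneg' l)
  · have hh := holder_conjExp hp
    have hq := hh.symm.pos
    have h1 := Real.inner_le_Lp_mul_Lq (Finset.range N) (fun j => ‖l j‖) (fun j => ‖g j‖) hh.symm
    simp only [abs_norm] at h1
    refine h1.trans (mul_le_mul ?_ ?_ (by positivity) (lp.norm_nonneg' l))
    · rw [one_div, Real.rpow_inv_le_iff_of_pos (by positivity) (lp.norm_nonneg' l) hq]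
      exact lp.sum_rpow_le_norm_rpow hq l _
    · rw [one_div, Real.rpow_inv_le_iff_of_pos (by positivity) hW hh.pos]
      exact hg N

theorem IsSigmaRep.norm_apply_le {p : ℝ} (hp : 1 ≤ p) {A : ContinuousMultilinearMap 𝕜 E F}
    {l : lp (fun _ : ℕ => 𝕜) (conjExp p)} {x' : ℕ → ∀ i, StrongDual 𝕜 (E i)} {y : ℕ → F}
    (h : IsSigmaRep p A l x' y) {x : ∀ i, E i} (hx : ∀ i, ‖x i‖ ≤ 1) :
    ‖A x‖ ≤ ‖l‖ * (sigmaSup p x' y 0).toReal := by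
  have hp0 : 0 < p := by linarith
  obtain ⟨y', hy', hAy⟩ := exists_dual_vector'' 𝕜 (A x)
  set W := (sigmaSup p x' y 0).toReal with hW
  have hW0 : 0 ≤ W := ENNReal.toReal_nonneg
  set g : ℕ → 𝕜 := fun j => (∏ i, x' j i (x i)) * y' (y j) with hg
  have hgW : ∀ N, ∑ j ∈ Finset.range N, ‖g j‖ ^ p ≤ W ^ p := by
    intro N
    have h1 := le_sigmaSup_rpow hp x' y 0 hx hy'
    have h2 := (ENNReal.sum_le_tsum (Finset.range N)).trans h1
    rw [← ENNReal.ofReal_toReal h.sup_lt_top.ne, ← hW,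
      ENNReal.ofReal_rpow_of_nonneg hW0 hp0.le] at h2
    rw [← ENNReal.ofReal_le_ofReal_iff (by positivity),
      ENNReal.ofReal_sum_of_nonneg (fun _ _ => by positivity)]
    refine le_trans (le_of_eq (Finset.sum_congr rfl fun j _ => ?_)) h2
    rw [← ENNReal.ofReal_rpow_of_nonneg (norm_nonneg _) hp0.le, ofReal_norm]
    rfl
  have ht : Filter.Tendsto
      (fun N => ‖y' (∑ j ∈ Finset.range N, l j • elemTensor (x' j) (y j) x)‖)
      Filter.atTop (𝓝 ‖y' (A x)‖) :=
    ((y'.continuous.tendsto _).comp (h.tendsto_sum x)).norm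
  have hfin : ‖y' (A x)‖ ≤ ‖l‖ * W := by
    refine le_of_tendsto ht (Filter.Eventually.of_forall fun N => ?_)
    refine le_trans ?_ (sum_norm_mul_le hp l g hW0 hgW N)
    rw [map_sum]
    refine (norm_sum_le _ _).trans (le_of_eq (Finset.sum_congr rfl fun j _ => ?_))
    rw [← norm_mul]
    congr 1
    simp [hg]
  rw [hAy] at hfin
  simpa using hfin

theorem eq_zero_of_unit_ball {G : Type*} [NormedAddCommGroup G] [NormedSpace 𝕜 G]
    (A : ContinuousMultilinearMap 𝕜 E G) (h : ∀ x : ∀ i, E i, (∀ i, ‖x i‖ ≤ 1) → A x = 0) :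
    A = 0 := by
  ext x
  have h1 := h (fun i => (((‖x i‖ + 1)⁻¹ : ℝ) : 𝕜) • x i) fun i => by
    rw [norm_smul, RCLike.norm_ofReal, abs_of_pos (by positivity), inv_mul_le_iff₀ (by positivity)]
    linarith
  rw [ContinuousMultilinearMap.map_smul_univ, smul_eq_zero] at h1
  refine h1.resolve_left (Finset.prod_ne_zero_iff.2 fun i _ => ?_)
  exact RCLike.ofReal_ne_zero.2 (by positivity)

theorem eq_zero_of_sigmaNorm_eq_zero {p : ℝ} (hp : 1 ≤ p) {A : ContinuousMultilinearMap 𝕜 E F}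
    (hA : IsSigmaNuclear p A) (h0 : sigmaNorm p A = 0) : A = 0 := by
  refine eq_zero_of_unit_ball A fun x hx => norm_le_zero_iff.1 ?_
  refine le_of_forall_pos_le_add fun ε hε => ?_
  obtain ⟨l, x', y, h, hlt⟩ := hA.exists_lt (s := ε) (by rwa [h0])
  rw [zero_add]
  exact (h.norm_apply_le hp hx).trans hlt.le

theorem norm_prod_mul_le {ι : Type*} [Fintype ι] {a : ι → ℝ} {f : ι → 𝕜} {z : 𝕜} {c : ℝ}
    (hf : ∀ i, ‖f i‖ ≤ a i) (hz : ‖z‖ ≤ c) : ‖(∏ i, f i) * z‖ ≤ (∏ i, a i) * c := by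
  rw [norm_mul, norm_prod]
  exact mul_le_mul (Finset.prod_le_prod (fun _ _ => norm_nonneg _) fun i _ => hf i) hz
    (norm_nonneg _) (Finset.prod_nonneg fun i _ => (norm_nonneg _).trans (hf i))

theorem norm_apply_le_of_le_one {X : Type*} [NormedAddCommGroup X] [NormedSpace 𝕜 X]
    (f : StrongDual 𝕜 X) {x : X} (hx : ‖x‖ ≤ 1) : ‖f x‖ ≤ ‖f‖ :=
  (f.le_opNorm x).trans (mul_le_of_le_one_right (norm_nonneg f) hx)

theorem norm_apply_le_of_norm_le_one {X : Type*} [NormedAddCommGroup X] [NormedSpace 𝕜 X]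
    {f : StrongDual 𝕜 X} (hf : ‖f‖ ≤ 1) (x : X) : ‖f x‖ ≤ ‖x‖ :=
  (f.le_opNorm x).trans (mul_le_of_le_one_left (norm_nonneg x) hf)

theorem sigmaSup_single_le {p : ℝ} (hp : 1 ≤ p) (x' : ∀ i, StrongDual 𝕜 (E i)) (y : F) :
    sigmaSup p (fun _ => x') (Pi.single 0 y) 0 ≤ ENNReal.ofReal ((∏ i, ‖x' i‖) * ‖y‖) := by
  have hp0 : 0 < p := by linarith
  refine sigmaSup_le hp fun x hx y' hy' => ?_
  rw [tsum_eq_single 0 fun j hj => by simp [hj, hp0]]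
  refine ENNReal.rpow_le_rpow ?_ hp0.le
  rw [← ofReal_norm]
  refine ENNReal.ofReal_le_ofReal (norm_prod_mul_le (fun i => norm_apply_le_of_le_one _ (hx i)) ?_)
  simpa using norm_apply_le_of_norm_le_one hy' y

theorem isSigmaRep_elemTensor {p : ℝ} (hp : 1 ≤ p) (x' : ∀ i, StrongDual 𝕜 (E i)) (y : F) :
    IsSigmaRep p (elemTensor x' y) (lp.single (conjExp p) 0 (1 : 𝕜)) (fun _ => x')
      (Pi.single 0 y) where
  tendsto_sum x := by
    refine tendsto_const_nhds.congr' ?_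
    filter_upwards [Filter.eventually_ge_atTop 1] with N hN
    rw [Finset.sum_eq_single_of_mem 0 (Finset.mem_range.2 hN) fun j _ hj => by simp [hj]]
    simp
  sup_lt_top := (sigmaSup_single_le hp x' y).trans_lt ENNReal.ofReal_lt_top
  tendsto_tail := by
    have hp0 : 0 < p := by linarith
    refine tendsto_const_nhds.congr' ?_
    filter_upwards [Filter.eventually_ge_atTop 1] with N hN
    refine (nonpos_iff_eq_zero.1 (sigmaSup_le hp fun x hx y' hy' => ?_)).symm
    have : ∀ j, (Pi.single 0 y : ℕ → F) (j + N) = 0 := fun j => by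
      rw [Pi.single_apply, if_neg (by omega)]
    simp [this, hp0]

theorem sigmaNorm_elemTensor_le {p : ℝ} (hp : 1 ≤ p) (x' : ∀ i, StrongDual 𝕜 (E i)) (y : F) :
    sigmaNorm p (elemTensor x' y) ≤ (∏ i, ‖x' i‖) * ‖y‖ := by
  refine (sigmaNorm_le (isSigmaRep_elemTensor hp x' y)).trans ?_
  rw [lp.norm_single (zero_lt_one.trans_le (one_le_conjExp hp)), norm_one, one_mul]
  exact ENNReal.toReal_le_of_le_ofReal (by positivity) (sigmaSup_single_le hp x' y)

theorem isSigmaNuclear_elemTensor {p : ℝ} (hp : 1 ≤ p) (x' : ∀ i, StrongDual 𝕜 (E i)) (y : F) :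
    IsSigmaNuclear p (elemTensor x' y) :=
  ⟨_, _, _, isSigmaRep_elemTensor hp x' y⟩

theorem isSigmaNuclear_zero {p : ℝ} (hp : 1 ≤ p) :
    IsSigmaNuclear p (0 : ContinuousMultilinearMap 𝕜 E F) := by
  have : elemTensor (0 : ∀ i, StrongDual 𝕜 (E i)) (0 : F) = 0 := by ext x; simp
  exact this ▸ isSigmaNuclear_elemTensor hp 0 0

/-! ### Basic facts on quasi-`τ(p)`-summing operators -/

theorem isQuasiTauBound_zero {p : ℝ} (hp : 1 ≤ p) :
    IsQuasiTauBound p (0 : ContinuousMultilinearMap 𝕜 E (StrongDual 𝕜 F)) 0 := by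
  have hp0 : 0 < p := by linarith
  refine ⟨le_rfl, fun m x y => ?_⟩
  simp [hp0]

theorem IsQuasiTauBound.add {p : ℝ} (hp : 1 ≤ p)
    {S T : ContinuousMultilinearMap 𝕜 E (StrongDual 𝕜 F)} {C D : ℝ}
    (hS : IsQuasiTauBound p S C) (hT : IsQuasiTauBound p T D) :
    IsQuasiTauBound p (S + T) (C + D) := by
  have hp0 : 0 < p := by linarith
  refine ⟨add_nonneg hS.1 hT.1, fun m x y => ?_⟩
  rw [ENNReal.ofReal_add hS.1 hT.1, add_mul]
  refine le_trans ?_ (add_le_add (hS.2 m x y) (hT.2 m x y))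
  refine le_trans ?_ (ENNReal.Lp_add_le _ _ _ hp)
  refine ENNReal.rpow_le_rpow (Finset.sum_le_sum fun j _ => ENNReal.rpow_le_rpow ?_ hp0.le)
    (by positivity)
  exact enorm_add_le _ _

theorem IsQuasiTauBound.smul {p : ℝ} (hp : 1 ≤ p)
    {S : ContinuousMultilinearMap 𝕜 E (StrongDual 𝕜 F)} {C : ℝ}
    (hS : IsQuasiTauBound p S C) (c : 𝕜) : IsQuasiTauBound p (c • S) (‖c‖ * C) := by
  have hp0 : 0 < p := by linarith
  refine ⟨mul_nonneg (norm_nonneg c) hS.1, fun m x y => ?_⟩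
  rw [ENNReal.ofReal_mul (norm_nonneg c), ofReal_norm, mul_assoc]
  refine le_trans (le_of_eq ?_) (mul_le_mul_right (hS.2 m x y) _)
  have : ∀ j, ‖(c • S) (x j) (y j)‖ₑ ^ p = ‖c‖ₑ ^ p * ‖S (x j) (y j)‖ₑ ^ p := fun j => by
    rw [← ENNReal.mul_rpow_of_nonneg _ _ hp0.le, ← enorm_mul]
    rfl
  simp only [this]
  rw [← Finset.mul_sum, ENNReal.mul_rpow_of_nonneg _ _ (by positivity), ← ENNReal.rpow_mul,
    mul_one_div_cancel hp0.ne', ENNReal.rpow_one]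

theorem quasiTauNorm_nonneg (p : ℝ) (S : ContinuousMultilinearMap 𝕜 E (StrongDual 𝕜 F)) :
    0 ≤ quasiTauNorm p S :=
  Real.sInf_nonneg fun _ h => h.1

theorem quasiTauNorm_le {p : ℝ} {S : ContinuousMultilinearMap 𝕜 E (StrongDual 𝕜 F)} {C : ℝ}
    (h : IsQuasiTauBound p S C) : quasiTauNorm p S ≤ C :=
  csInf_le ⟨0, fun _ h => h.1⟩ h

theorem IsQuasiTau.exists_lt {p : ℝ} {S : ContinuousMultilinearMap 𝕜 E (StrongDual 𝕜 F)}
    (h : IsQuasiTau p S) {s : ℝ} (hs : quasiTauNorm p S < s) : ∃ C, IsQuasiTauBound p S C ∧ C < s :=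
  exists_lt_of_csInf_lt h hs

theorem quasiTauNorm_add_le {p : ℝ} (hp : 1 ≤ p)
    {S T : ContinuousMultilinearMap 𝕜 E (StrongDual 𝕜 F)} (hS : IsQuasiTau p S)
    (hT : IsQuasiTau p T) : quasiTauNorm p (S + T) ≤ quasiTauNorm p S + quasiTauNorm p T := by
  refine le_of_forall_pos_le_add fun ε hε => ?_
  obtain ⟨C, hC, hCs⟩ := hS.exists_lt (s := quasiTauNorm p S + ε / 2) (by linarith)
  obtain ⟨D, hD, hDs⟩ := hT.exists_lt (s := quasiTauNorm p T + ε / 2) (by linarith)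
  have := quasiTauNorm_le (hC.add hp hD)
  linarith

theorem quasiTauNorm_smul_le {p : ℝ} (hp : 1 ≤ p)
    {S : ContinuousMultilinearMap 𝕜 E (StrongDual 𝕜 F)} (hS : IsQuasiTau p S) (c : 𝕜) :
    quasiTauNorm p (c • S) ≤ ‖c‖ * quasiTauNorm p S := by
  refine le_of_tendsto_of_tendsto (f := fun _ : ℝ => quasiTauNorm p (c • S))
    (g := fun s => ‖c‖ * s) (b := 𝓝[>] (quasiTauNorm p S)) tendsto_const_nhds
    (((continuous_const_mul ‖c‖).tendsto _).mono_left nhdsWithin_le_nhds) ?_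
  filter_upwards [self_mem_nhdsWithin] with s hs
  obtain ⟨C, hC, hCs⟩ := hS.exists_lt hs
  exact (quasiTauNorm_le (hC.smul hp c)).trans (mul_le_mul_of_nonneg_left hCs.le (norm_nonneg c))

theorem IsQuasiTauBound.norm_apply_le {p : ℝ} (hp : 1 ≤ p)
    {S : ContinuousMultilinearMap 𝕜 E (StrongDual 𝕜 F)} {C : ℝ} (hS : IsQuasiTauBound p S C)
    (x : ∀ i, E i) (y : F) : ‖S x y‖ ≤ C * ((∏ i, ‖x i‖) * ‖y‖) := by
  have hp0 : 0 < p := by linarith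
  have h := hS.2 1 (fun _ => x) (fun _ => y)
  have h2 : quasiTauSup 𝕜 p (fun _ : Fin 1 => x) (fun _ => y) ≤
      ENNReal.ofReal ((∏ i, ‖x i‖) * ‖y‖) := by
    unfold quasiTauSup
    refine iSup_le fun x' => iSup_le fun hx' => iSup_le fun y' => iSup_le fun hy' => ?_
    rw [one_div, ENNReal.rpow_inv_le_iff hp0, Fin.sum_univ_one, ← ofReal_norm]
    refine ENNReal.rpow_le_rpow (ENNReal.ofReal_le_ofReal (norm_prod_mul_le (fun i => ?_) ?_)) hp0.le
    · exact norm_apply_le_of_norm_le_one (hx' i) _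
    · exact norm_apply_le_of_norm_le_one hy' _
  rw [Fin.sum_univ_one, ← ENNReal.rpow_mul, mul_one_div_cancel hp0.ne', ENNReal.rpow_one] at h
  have h3 := h.trans (mul_le_mul_right h2 _)
  rw [← ENNReal.ofReal_mul hS.1, ← ofReal_norm] at h3
  exact (ENNReal.ofReal_le_ofReal_iff (mul_nonneg hS.1 (by positivity))).1 h3

theorem eq_zero_of_quasiTauNorm_eq_zero {p : ℝ} (hp : 1 ≤ p)
    {S : ContinuousMultilinearMap 𝕜 E (StrongDual 𝕜 F)} (hS : IsQuasiTau p S)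
    (h0 : quasiTauNorm p S = 0) : S = 0 := by
  ext x y
  refine norm_le_zero_iff.1 (le_of_tendsto_of_tendsto (f := fun _ : ℝ => ‖S x y‖)
    (g := fun s => s * ((∏ i, ‖x i‖) * ‖y‖)) (b := 𝓝[>] 0) tendsto_const_nhds ?_ ?_)
  · have := ((continuous_mul_const ((∏ i, ‖x i‖) * ‖y‖)).tendsto (0 : ℝ))
    rw [zero_mul] at this
    exact this.mono_left nhdsWithin_le_nhds
  · filter_upwards [self_mem_nhdsWithin] with s hs
    obtain ⟨C, hC, hCs⟩ := hS.exists_lt (s := s) (by rwa [h0])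
    exact (hC.norm_apply_le hp x y).trans
      (mul_le_mul_of_nonneg_right hCs.le (by positivity))

end Definitions

/-! ### The normed spaces of `σ(p)`-nuclear and of quasi-`τ(p)`-summing operators -/

section Spaces

variable (𝕜 : Type w) [RCLike 𝕜] (p : ℝ) [Fact (1 ≤ p)] {n : ℕ} (E : Fin n → Type u)
  [∀ i, NormedAddCommGroup (E i)] [∀ i, NormedSpace 𝕜 (E i)] (F : Type v) [NormedAddCommGroup F]
  [NormedSpace 𝕜 F]

/-- The `σ(p)`-nuclear operators, as a linear subspace of the continuous `n`-linear operators. -/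
def sigmaNuclearSubmodule : Submodule 𝕜 (ContinuousMultilinearMap 𝕜 E F) where
  carrier := {A | IsSigmaNuclear p A}
  add_mem' hA hB := hA.add Fact.out hB
  zero_mem' := isSigmaNuclear_zero Fact.out
  smul_mem' c _ hA := hA.smul Fact.out c

/-- The space `𝓛_{σ(p)}(E₁, …, Eₙ; F)`; its norm is the `σ(p)`-nuclear norm. -/
def SigmaNuclear : Type (max u v) := sigmaNuclearSubmodule 𝕜 p E F

instance : AddCommGroup (SigmaNuclear 𝕜 p E F) :=
  inferInstanceAs (AddCommGroup (sigmaNuclearSubmodule 𝕜 p E F))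

instance : Module 𝕜 (SigmaNuclear 𝕜 p E F) :=
  inferInstanceAs (Module 𝕜 (sigmaNuclearSubmodule 𝕜 p E F))

instance : Norm (SigmaNuclear 𝕜 p E F) := ⟨fun A => sigmaNorm p A.1⟩

/-- The quasi-`τ(p)`-summing operators, as a linear subspace of the continuous `n`-linear
operators. -/
def quasiTauSubmodule : Submodule 𝕜 (ContinuousMultilinearMap 𝕜 E (StrongDual 𝕜 F)) where
  carrier := {S | IsQuasiTau p S}
  add_mem' := fun ⟨_, hC⟩ ⟨_, hD⟩ => ⟨_, hC.add Fact.out hD⟩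
  zero_mem' := ⟨_, isQuasiTauBound_zero Fact.out⟩
  smul_mem' := fun c _ ⟨_, hC⟩ => ⟨_, hC.smul Fact.out c⟩

/-- The space `𝓛_{qτ(p)}(E₁, …, Eₙ; F')`; its norm is the quasi-`τ(p)`-summing norm. -/
def QuasiTau : Type (max u v w) := quasiTauSubmodule 𝕜 p E F

instance : AddCommGroup (QuasiTau 𝕜 p E F) :=
  inferInstanceAs (AddCommGroup (quasiTauSubmodule 𝕜 p E F))

instance : Module 𝕜 (QuasiTau 𝕜 p E F) :=
  inferInstanceAs (Module 𝕜 (quasiTauSubmodule 𝕜 p E F))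

instance : Norm (QuasiTau 𝕜 p E F) := ⟨fun S => quasiTauNorm p S.1⟩

/-- A nonnegative, subadditive, subhomogeneous and definite function is a norm. -/
theorem normCore {X : Type*} [AddCommGroup X] [Module 𝕜 X] [Norm X] (h0 : ∀ x : X, 0 ≤ ‖x‖)
    (h1 : ∀ x y : X, ‖x + y‖ ≤ ‖x‖ + ‖y‖) (h2 : ∀ (c : 𝕜) (x : X), ‖c • x‖ ≤ ‖c‖ * ‖x‖)
    (h3 : ∀ x : X, ‖x‖ = 0 → x = 0) : NormedSpace.Core 𝕜 X where
  norm_nonneg := h0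
  norm_smul c x := by
    refine le_antisymm (h2 c x) ?_
    rcases eq_or_ne c 0 with rfl | hc
    · simpa using h0 _
    · have := h2 c⁻¹ (c • x)
      rw [inv_smul_smul₀ hc, norm_inv] at this
      calc ‖c‖ * ‖x‖ ≤ ‖c‖ * (‖c‖⁻¹ * ‖c • x‖) := mul_le_mul_of_nonneg_left this (norm_nonneg c)
        _ = ‖c • x‖ := mul_inv_cancel_left₀ (norm_ne_zero_iff.2 hc) _
  norm_triangle := h1
  norm_eq_zero_iff x := by
    refine ⟨h3 x, ?_⟩
    rintro rfl
    refine le_antisymm ?_ (h0 _)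
    have := h2 0 0
    rwa [smul_zero, norm_zero, zero_mul] at this

theorem SigmaNuclear.core : NormedSpace.Core 𝕜 (SigmaNuclear 𝕜 p E F) :=
  normCore 𝕜 (fun A => sigmaNorm_nonneg p A.1) (fun A B => sigmaNorm_add_le Fact.out A.2 B.2)
    (fun c A => sigmaNorm_smul_le Fact.out A.2 c)
    (fun A h => Subtype.ext (eq_zero_of_sigmaNorm_eq_zero Fact.out A.2 h))

instance : NormedAddCommGroup (SigmaNuclear 𝕜 p E F) :=
  NormedAddCommGroup.ofCore (SigmaNuclear.core 𝕜 p E F)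

instance : NormedSpace 𝕜 (SigmaNuclear 𝕜 p E F) :=
  NormedSpace.ofCore (SigmaNuclear.core 𝕜 p E F)

theorem QuasiTau.core : NormedSpace.Core 𝕜 (QuasiTau 𝕜 p E F) :=
  normCore 𝕜 (fun S => quasiTauNorm_nonneg p S.1) (fun S T => quasiTauNorm_add_le Fact.out S.2 T.2)
    (fun c S => quasiTauNorm_smul_le Fact.out S.2 c)
    (fun S h => Subtype.ext (eq_zero_of_quasiTauNorm_eq_zero Fact.out S.2 h))

instance : NormedAddCommGroup (QuasiTau 𝕜 p E F) :=
  NormedAddCommGroup.ofCore (QuasiTau.core 𝕜 p E F)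

instance : NormedSpace 𝕜 (QuasiTau 𝕜 p E F) :=
  NormedSpace.ofCore (QuasiTau.core 𝕜 p E F)

variable {𝕜 E F}

/-- The `n`-linear operator underlying an element of `𝓛_{σ(p)}(E₁, …, Eₙ; F)`. -/
def SigmaNuclear.toMultilinear (A : SigmaNuclear 𝕜 p E F) : ContinuousMultilinearMap 𝕜 E F := A.1

theorem SigmaNuclear.norm_def (A : SigmaNuclear 𝕜 p E F) :
    ‖A‖ = sigmaNorm p (A.toMultilinear p) := rfl

/-- The `n`-linear operator underlying an element of `𝓛_{qτ(p)}(E₁, …, Eₙ; F')`. -/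
def QuasiTau.toMultilinear (S : QuasiTau 𝕜 p E F) :
    ContinuousMultilinearMap 𝕜 E (StrongDual 𝕜 F) := S.1

theorem QuasiTau.norm_def (S : QuasiTau 𝕜 p E F) :
    ‖S‖ = quasiTauNorm p (S.toMultilinear p) := rfl

/-- `x'₁ ⊗ ⋯ ⊗ x'ₙ ⊗ y` as an element of `𝓛_{σ(p)}(E₁, …, Eₙ; F)`. -/
def SigmaNuclear.tensor (x' : ∀ i, StrongDual 𝕜 (E i)) (y : F) : SigmaNuclear 𝕜 p E F :=
  ⟨elemTensor x' y, isSigmaNuclear_elemTensor Fact.out x' y⟩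

theorem SigmaNuclear.norm_tensor_le (x' : ∀ i, StrongDual 𝕜 (E i)) (y : F) :
    ‖SigmaNuclear.tensor p x' y‖ ≤ (∏ i, ‖x' i‖) * ‖y‖ :=
  sigmaNorm_elemTensor_le Fact.out x' y

theorem SigmaNuclear.tensor_add (x' : ∀ i, StrongDual 𝕜 (E i)) (y z : F) :
    tensor p x' (y + z) = tensor p x' y + tensor p x' z := by
  refine Subtype.ext ?_
  show elemTensor x' (y + z) = elemTensor x' y + elemTensor x' z
  ext x
  simp

theorem SigmaNuclear.tensor_smul (x' : ∀ i, StrongDual 𝕜 (E i)) (c : 𝕜) (y : F) :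
    tensor p x' (c • y) = c • tensor p x' y := by
  refine Subtype.ext ?_
  show elemTensor x' (c • y) = c • elemTensor x' y
  ext x
  simp [smul_smul, mul_comm]

theorem prod_update [DecidableEq (Fin n)] (x' : ∀ i, StrongDual 𝕜 (E i)) (i : Fin n)
    (a : StrongDual 𝕜 (E i)) (x : ∀ i, E i) :
    ∏ j, Function.update x' i a j (x j) = a (x i) * ∏ j ∈ Finset.univ.erase i, x' j (x j) := by
  rw [← Finset.mul_prod_erase _ _ (Finset.mem_univ i), Function.update_self]
  congr 1
  refine Finset.prod_congr rfl fun j hj => ?_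
  rw [Function.update_of_ne (Finset.ne_of_mem_erase hj)]

theorem SigmaNuclear.tensor_update_add [DecidableEq (Fin n)] (x' : ∀ i, StrongDual 𝕜 (E i))
    (i : Fin n) (a b : StrongDual 𝕜 (E i)) (y : F) :
    tensor p (Function.update x' i (a + b)) y =
      tensor p (Function.update x' i a) y + tensor p (Function.update x' i b) y := by
  refine Subtype.ext ?_
  show elemTensor (Function.update x' i (a + b)) y =
    elemTensor (Function.update x' i a) y + elemTensor (Function.update x' i b) y
  ext x
  rw [add_apply]
  simp only [elemTensor_apply, prod_update, ← add_smul, ← add_mul]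
  rfl

theorem SigmaNuclear.tensor_update_smul [DecidableEq (Fin n)] (x' : ∀ i, StrongDual 𝕜 (E i))
    (i : Fin n) (c : 𝕜) (a : StrongDual 𝕜 (E i)) (y : F) :
    tensor p (Function.update x' i (c • a)) y = c • tensor p (Function.update x' i a) y := by
  refine Subtype.ext ?_
  show elemTensor (Function.update x' i (c • a)) y = c • elemTensor (Function.update x' i a) y
  ext x
  rw [smul_apply]
  simp only [elemTensor_apply, prod_update, smul_smul, ← mul_assoc]
  rfl

/-- The Borel transform `𝓑(φ)(x'₁, …, x'ₙ)(y) = φ(x'₁ ⊗ ⋯ ⊗ x'ₙ ⊗ y)` of a bounded linear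
functional `φ` on `𝓛_{σ(p)}(E₁, …, Eₙ; F)`. -/
def borelTransform (φ : StrongDual 𝕜 (SigmaNuclear 𝕜 p E F)) :
    ContinuousMultilinearMap 𝕜 (fun i => StrongDual 𝕜 (E i)) (StrongDual 𝕜 F) :=
  have key : ∀ (x' : ∀ i, StrongDual 𝕜 (E i)) (y : F),
      ‖φ (SigmaNuclear.tensor p x' y)‖ ≤ ‖φ‖ * (∏ i, ‖x' i‖) * ‖y‖ := fun x' y => by
    rw [mul_assoc]
    exact (φ.le_opNorm _).trans
      (mul_le_mul_of_nonneg_left (SigmaNuclear.norm_tensor_le p x' y) (norm_nonneg φ))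
  MultilinearMap.mkContinuous
    { toFun := fun x' => LinearMap.mkContinuous
        { toFun := fun y => φ (SigmaNuclear.tensor p x' y)
          map_add' := fun y z => by rw [SigmaNuclear.tensor_add, map_add]
          map_smul' := fun c y => by rw [SigmaNuclear.tensor_smul, map_smul, RingHom.id_apply] }
        (‖φ‖ * ∏ i, ‖x' i‖) (key x')
      map_update_add' := fun x' i a b => by
        ext y
        simp [SigmaNuclear.tensor_update_add]
      map_update_smul' := fun x' i c a => by
        ext y
        simp [SigmaNuclear.tensor_update_smul] }
    ‖φ‖ (fun x' => LinearMap.mkContinuous_norm_le _ (by positivity) (key x'))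

@[simp]
theorem borelTransform_apply (φ : StrongDual 𝕜 (SigmaNuclear 𝕜 p E F))
    (x' : ∀ i, StrongDual 𝕜 (E i)) (y : F) :
    borelTransform p φ x' y = φ (SigmaNuclear.tensor p x' y) := rfl

end Spaces

/-! ### The linear case -/

section Linear

variable (𝕜 : Type w) [RCLike 𝕜] (p : ℝ) [Fact (1 ≤ p)] (E : Type u)
  [NormedAddCommGroup E] [NormedSpace 𝕜 E] (F : Type v) [NormedAddCommGroup F] [NormedSpace 𝕜 F]

/-- The identification of bounded linear operators with continuous `1`-linear operators,
`u ↦ (x ↦ u (x 0))`. -/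
def toOneLinear : (E →L[𝕜] F) ≃ₗᵢ[𝕜] ContinuousMultilinearMap 𝕜 (fun _ : Fin 1 => E) F :=
  ContinuousMultilinearMap.ofSubsingletonₗᵢ 𝕜 E (0 : Fin 1)

/-- The linear operators that are `σ(p)`-nuclear, as `1`-linear operators. -/
def sigmaNuclearOpSubmodule : Submodule 𝕜 (E →L[𝕜] F) :=
  (sigmaNuclearSubmodule 𝕜 p (fun _ : Fin 1 => E) F).comap
    (toOneLinear 𝕜 E F).toLinearEquiv.toLinearMap

/-- The space `𝓛_{σ(p)}(E; F)` of `σ(p)`-nuclear linear operators. -/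
def SigmaNuclearOp : Type (max u v) := sigmaNuclearOpSubmodule 𝕜 p E F

instance : AddCommGroup (SigmaNuclearOp 𝕜 p E F) :=
  inferInstanceAs (AddCommGroup (sigmaNuclearOpSubmodule 𝕜 p E F))

instance : Module 𝕜 (SigmaNuclearOp 𝕜 p E F) :=
  inferInstanceAs (Module 𝕜 (sigmaNuclearOpSubmodule 𝕜 p E F))

/-- The inclusion of `𝓛_{σ(p)}(E; F)` into the space of `σ(p)`-nuclear `1`-linear operators. -/
def SigmaNuclearOp.incl :
    SigmaNuclearOp 𝕜 p E F →ₗ[𝕜] SigmaNuclear 𝕜 p (fun _ : Fin 1 => E) F where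
  toFun u := ⟨toOneLinear 𝕜 E F u.1, u.2⟩
  map_add' u v := Subtype.ext ((toOneLinear 𝕜 E F).map_add u.1 v.1)
  map_smul' c u := Subtype.ext ((toOneLinear 𝕜 E F).map_smul c u.1)

theorem SigmaNuclearOp.incl_injective : Function.Injective (SigmaNuclearOp.incl 𝕜 p E F) :=
  fun _ _ h => Subtype.ext ((toOneLinear 𝕜 E F).injective (congrArg Subtype.val h))

instance : NormedAddCommGroup (SigmaNuclearOp 𝕜 p E F) :=
  NormedAddCommGroup.induced _ _ (SigmaNuclearOp.incl 𝕜 p E F)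
    (SigmaNuclearOp.incl_injective 𝕜 p E F)

instance : NormedSpace 𝕜 (SigmaNuclearOp 𝕜 p E F) :=
  NormedSpace.induced 𝕜 _ _ (SigmaNuclearOp.incl 𝕜 p E F)

/-- The linear operators that are quasi-`τ(p)`-summing, as `1`-linear operators. -/
def quasiTauOpSubmodule : Submodule 𝕜 (E →L[𝕜] StrongDual 𝕜 F) :=
  (quasiTauSubmodule 𝕜 p (fun _ : Fin 1 => E) F).comap
    (toOneLinear 𝕜 E (StrongDual 𝕜 F)).toLinearEquiv.toLinearMap

/-- The space `𝓛_{qτ(p)}(E; F')` of quasi-`τ(p)`-summing linear operators. -/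
def QuasiTauOp : Type (max u v w) := quasiTauOpSubmodule 𝕜 p E F

instance : AddCommGroup (QuasiTauOp 𝕜 p E F) :=
  inferInstanceAs (AddCommGroup (quasiTauOpSubmodule 𝕜 p E F))

instance : Module 𝕜 (QuasiTauOp 𝕜 p E F) :=
  inferInstanceAs (Module 𝕜 (quasiTauOpSubmodule 𝕜 p E F))

/-- The inclusion of `𝓛_{qτ(p)}(E; F')` into the space of quasi-`τ(p)`-summing `1`-linear
operators. -/
def QuasiTauOp.incl : QuasiTauOp 𝕜 p E F →ₗ[𝕜] QuasiTau 𝕜 p (fun _ : Fin 1 => E) F where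
  toFun u := ⟨toOneLinear 𝕜 E (StrongDual 𝕜 F) u.1, u.2⟩
  map_add' u v := Subtype.ext ((toOneLinear 𝕜 E (StrongDual 𝕜 F)).map_add u.1 v.1)
  map_smul' c u := Subtype.ext ((toOneLinear 𝕜 E (StrongDual 𝕜 F)).map_smul c u.1)

theorem QuasiTauOp.incl_injective : Function.Injective (QuasiTauOp.incl 𝕜 p E F) :=
  fun _ _ h => Subtype.ext
    ((toOneLinear 𝕜 E (StrongDual 𝕜 F)).injective (congrArg Subtype.val h))

instance : NormedAddCommGroup (QuasiTauOp 𝕜 p E F) :=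
  NormedAddCommGroup.induced _ _ (QuasiTauOp.incl 𝕜 p E F) (QuasiTauOp.incl_injective 𝕜 p E F)

instance : NormedSpace 𝕜 (QuasiTauOp 𝕜 p E F) :=
  NormedSpace.induced 𝕜 _ _ (QuasiTauOp.incl 𝕜 p E F)

variable {𝕜 E F}

/-- The linear operator underlying an element of `𝓛_{σ(p)}(E; F)`. -/
def SigmaNuclearOp.toLin (u : SigmaNuclearOp 𝕜 p E F) : E →L[𝕜] F := u.1

theorem SigmaNuclearOp.norm_def (u : SigmaNuclearOp 𝕜 p E F) :
    ‖u‖ = sigmaNorm p (toOneLinear 𝕜 E F (u.toLin p)) := rfl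

/-- The linear operator underlying an element of `𝓛_{qτ(p)}(E; F')`. -/
def QuasiTauOp.toLin (u : QuasiTauOp 𝕜 p E F) : E →L[𝕜] StrongDual 𝕜 F := u.1

theorem QuasiTauOp.norm_def (u : QuasiTauOp 𝕜 p E F) :
    ‖u‖ = quasiTauNorm p (toOneLinear 𝕜 E (StrongDual 𝕜 F) (u.toLin p)) := rfl

/-- The operator `x' ⊗ y`, `x ↦ x'(x) y`, as an element of `𝓛_{σ(p)}(E; F)`. -/
def SigmaNuclearOp.tensor (x' : StrongDual 𝕜 E) (y : F) : SigmaNuclearOp 𝕜 p E F :=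
  ⟨x'.smulRight y, by
    have h : toOneLinear 𝕜 E F (x'.smulRight y) = elemTensor (fun _ : Fin 1 => x') y := by
      ext x
      simp [toOneLinear]
    show IsSigmaNuclear p (toOneLinear 𝕜 E F (x'.smulRight y))
    rw [h]
    exact isSigmaNuclear_elemTensor Fact.out _ y⟩

end Linear

end SigmaTau

end

/-! Write w_N for `sigmaSup p x' y N`, the supremum over the terms of index at least N. The duality
is Hölder's inequality between ℓ_p and ℓ_{p'}, once two suprema are matched: w_0 is taken over the
balls of the E_i, the quasi-τ(p) inequality over the balls of the E_i''. For finitely many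
functionals Goldstine's theorem makes them equal (`quasiTauSup_le_sigmaSup`,
`sigmaSup_le_quasiTauSup`).

Isometry. The partial sums of a representation converge to A in the σ(p)-norm, the N-th remainder
having norm at most ‖λ‖ w_N. Hence φ(A) = ∑ λ_j 𝓑(φ)(x'_j)(y_j), and Hölder gives ‖φ‖ ≤ C for every
admissible constant C of 𝓑(φ). Conversely, testing φ on ∑ λ_j x'_j ⊗ y_j, with λ the extremal
sequence in Hölder's inequality, shows that ‖φ‖ is itself admissible.

Surjectivity. Given S, the only candidate is φ(A) = ∑ λ_j S(x'_j)(y_j), which converges absolutely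
by Hölder. Linearity and boundedness follow once the sum is independent of the representation, that
is, once every representation of 0 gives the sum 0 (`IsSigmaRep.tendsto_sum_of_eq_zero`). This is
where the bounded approximation property enters. By Goldstine, a representation of 0 still sums to 0
when the x_i are replaced by elements of E_i''. If T_i is a finite rank operator on E_i', then S ∘
(T_1, …, T_n) expands into finitely many such bidual sums, so its series is 0 and its m-th partial
sum is minus a tail. That tail is at most ‖λ‖ C c^n w_m, uniformly over all T_i with ‖T_i‖ ≤ c.
Letting T_i tend to the identity on the first m functionals, with m fixed, gives the same bound for
S, and w_m → 0. -/

namespace SigmaTau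

/-! ### Goldstine's theorem for finitely many functionals. -/

section Goldstine

variable {𝕜 : Type w} [RCLike 𝕜]

/-- A form of **Goldstine's theorem**: on finitely many functionals, an element of the unit ball of
the bidual is approximated by elements of the unit ball of the space. -/
theorem mem_closure_eval {X : Type*} [NormedAddCommGroup X] [NormedSpace 𝕜 X] {ι : Type*}
    [Fintype ι] (f : ι → StrongDual 𝕜 X) {x'' : StrongDual 𝕜 (StrongDual 𝕜 X)} (hx : ‖x''‖ ≤ 1) :
    (fun j => x'' (f j)) ∈ closure ((fun x j => f j x) '' {x : X | ‖x‖ ≤ 1}) := by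
  classical
  let _ : NormedSpace ℝ X := NormedSpace.restrictScalars ℝ 𝕜 X
  have _ : IsScalarTower ℝ 𝕜 X := RestrictScalars.isScalarTower ℝ 𝕜 X
  by_contra hn
  have hb : Convex ℝ {x : X | ‖x‖ ≤ 1} := by
    have := convex_closedBall (0 : X) 1
    rwa [Metric.closedBall, show {x : X | dist x 0 ≤ 1} = {x : X | ‖x‖ ≤ 1} by simp] at this
  have hc : Convex ℝ ((fun (x : X) (j : ι) => f j x) '' {x : X | ‖x‖ ≤ 1}) :=
    hb.is_linear_image (f := fun (x : X) (j : ι) => f j x)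
      ⟨fun x y => by ext j; simp, fun c x => by
        ext j
        rw [← algebraMap_smul 𝕜 c x, map_smul, algebraMap_smul]
        rfl⟩
  obtain ⟨g, s, hg, hs⟩ := RCLike.geometric_hahn_banach_closed_point (𝕜 := 𝕜) hc.closure
    isClosed_closure hn
  have hgsum : ∀ z : ι → 𝕜, g z = ∑ j, g (Pi.single j 1) * z j := fun z => by
    conv_lhs => rw [← Finset.univ_sum_single z]
    rw [map_sum]
    refine Finset.sum_congr rfl fun j _ => ?_
    rw [mul_comm, ← smul_eq_mul, ← map_smul, ← Pi.single_smul, smul_eq_mul, mul_one]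
  -- The separating functional g on 𝕜^ι, composed with the evaluations, is this one functional on X.
  -- So g at the bidual point is x'' h, and a bound on ‖h‖ contradicts the separation.
  set h : StrongDual 𝕜 X := ∑ j, g (Pi.single j 1) • f j with hh
  have h1 : ∀ x : X, g (fun j => f j x) = h x := fun x => by
    rw [hgsum, hh, sum_apply]; rfl
  have h2 : g (fun j => x'' (f j)) = x'' h := by
    rw [hgsum, hh, map_sum]
    simp
  have hs0 : 0 < s := by
    simpa using hg 0 (subset_closure ⟨0, by simp, by ext; simp⟩)
  have hhs : ‖h‖ ≤ s := by
    refine ContinuousLinearMap.opNorm_le_of_unit_norm (𝕜 := 𝕜) hs0.le fun x hx => ?_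
    -- Separation bounds only real parts; a unimodular multiple of x turns h x into its norm.
    obtain ⟨c, hc1, hc2⟩ := RCLike.exists_norm_eq_mul_self (h x)
    have := hg _ (subset_closure ⟨c • x, by simp [norm_smul, hc1, hx], rfl⟩)
    rw [h1, map_smul, smul_eq_mul, ← hc2, RCLike.ofReal_re] at this
    exact this.le
  rw [h2] at hs
  have := (RCLike.re_le_norm _).trans ((x''.le_opNorm h).trans
    (mul_le_mul hx hhs (norm_nonneg _) zero_le_one))
  linarith

/-- A closed condition on the values of finitely many functionals passes from the unit balls of
the spaces to the unit balls of their biduals. -/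
theorem mem_of_forall_eval_mem {n : ℕ} {E : Fin n → Type u} [∀ i, NormedAddCommGroup (E i)]
    [∀ i, NormedSpace 𝕜 (E i)] {ι : Type*} [Fintype ι] (f : ι → ∀ i, StrongDual 𝕜 (E i))
    {s : Set (Fin n → ι → 𝕜)} (hs : IsClosed s)
    (h : ∀ x : ∀ i, E i, (∀ i, ‖x i‖ ≤ 1) → (fun i j => f j i (x i)) ∈ s)
    {x'' : ∀ i, StrongDual 𝕜 (StrongDual 𝕜 (E i))} (hx : ∀ i, ‖x'' i‖ ≤ 1) :
    (fun i j => x'' i (f j i)) ∈ s := by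
  have hmem : (fun i j => x'' i (f j i)) ∈ Set.univ.pi fun i : Fin n =>
      closure ((fun (x : E i) (j : ι) => f j i x) '' {x : E i | ‖x‖ ≤ 1}) :=
    fun i _ => mem_closure_eval (fun j => f j i) (hx i)
  -- Since closure commutes with products, all n variables are approximated at once and no iterated
  -- limits arise.
  rw [← closure_pi_set] at hmem
  refine closure_minimal ?_ hs hmem
  intro z hz
  choose x hx hxz using fun i => hz i (Set.mem_univ i)
  have : z = fun i j => f j i (x i) := by ext i j; exact (congrFun (hxz i) j).symm
  rw [this]
  exact h x hx

end Goldstine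

/-! ### Hölder estimates, remainders of representations, and representations of 0 on biduals. -/

section Estimates

variable {𝕜 : Type w} [RCLike 𝕜] {n : ℕ} {E : Fin n → Type u} [∀ i, NormedAddCommGroup (E i)]
  [∀ i, NormedSpace 𝕜 (E i)] {F : Type v} [NormedAddCommGroup F] [NormedSpace 𝕜 F] {p : ℝ}

/-- The truncation at N makes this a closed condition on finitely many values x''_i(x'_{ij}), so
Goldstine carries it from the balls of the E_i to those of the E_i''. -/
theorem sum_enorm_rpow_le_sigmaSup (hp : 1 ≤ p) (x' : ℕ → ∀ i, StrongDual 𝕜 (E i)) (y : ℕ → F)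
    (N : ℕ) {x'' : ∀ i, StrongDual 𝕜 (StrongDual 𝕜 (E i))} (hx : ∀ i, ‖x'' i‖ ≤ 1)
    {y' : StrongDual 𝕜 F} (hy : ‖y'‖ ≤ 1) :
    ∑ j : Fin N, ‖(∏ i, x'' i (x' j i)) * y' (y j)‖ₑ ^ p ≤ sigmaSup p x' y 0 ^ p := by
  have hp0 : 0 < p := by linarith
  refine mem_of_forall_eval_mem (fun j : Fin N => x' j)
    (s := {z | ∑ j : Fin N, ‖(∏ i, z i j) * y' (y j)‖ₑ ^ p ≤ sigmaSup p x' y 0 ^ p})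
    (isClosed_le ?_ continuous_const) (fun x hx => ?_) hx
  · refine continuous_finsetSum _ fun j _ => ENNReal.continuous_rpow_const.comp ?_
    exact continuous_enorm.comp ((continuous_finsetProd _ fun i _ => by fun_prop).mul
      continuous_const)
  · refine le_trans ?_ (le_sigmaSup_rpow hp x' y 0 hx hy)
    rw [Fin.sum_univ_eq_sum_range (fun j => ‖(∏ i, x' j i (x i)) * y' (y j)‖ₑ ^ p) N]
    exact ENNReal.sum_le_tsum _

theorem quasiTauSup_le_sigmaSup (hp : 1 ≤ p) (x' : ℕ → ∀ i, StrongDual 𝕜 (E i)) (y : ℕ → F)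
    (N : ℕ) : quasiTauSup 𝕜 p (fun j : Fin N => x' j) (fun j => y j) ≤ sigmaSup p x' y 0 := by
  have hp0 : 0 < p := by linarith
  unfold quasiTauSup
  refine iSup_le fun x'' => iSup_le fun hx => iSup_le fun y' => iSup_le fun hy => ?_
  rw [one_div, ENNReal.rpow_inv_le_iff hp0]
  exact sum_enorm_rpow_le_sigmaSup hp x' y N hx hy

theorem sum_enorm_rpow_le_quasiTauSup (hp : 1 ≤ p) {m : ℕ} (x : Fin m → ∀ i, E i)
    (y : Fin m → F) {x' : ∀ i, StrongDual 𝕜 (E i)} (hx : ∀ i, ‖x' i‖ ≤ 1) {y' : StrongDual 𝕜 F}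
    (hy : ‖y'‖ ≤ 1) :
    ∑ j, ‖(∏ i, x' i (x j i)) * y' (y j)‖ₑ ^ p ≤ quasiTauSup 𝕜 p x y ^ p := by
  have hp0 : 0 < p := by linarith
  rw [← ENNReal.rpow_inv_le_iff hp0, ← one_div]
  unfold quasiTauSup
  exact le_iSup_of_le x' (le_iSup_of_le hx (le_iSup_of_le y' (le_iSup_of_le hy le_rfl)))

/-- The functionals c⁻¹ (x'_i ∘ T_i) stay in the unit ball; rescaling the n factors costs c^n. -/
theorem quasiTauSup_comp_le (hp : 1 ≤ p) {c : ℝ} (hc : 0 < c) {T : ∀ i, E i →L[𝕜] E i}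
    (hT : ∀ i, ‖T i‖ ≤ c) {m : ℕ} (x : Fin m → ∀ i, E i) (y : Fin m → F) :
    quasiTauSup 𝕜 p (fun j i => T i (x j i)) y ≤ ENNReal.ofReal (c ^ n) * quasiTauSup 𝕜 p x y := by
  have hp0 : 0 < p := by linarith
  have hcK : (c : 𝕜) ≠ 0 := RCLike.ofReal_ne_zero.2 hc.ne'
  have hcn : ‖(c : 𝕜)‖ = c := by rw [RCLike.norm_ofReal, abs_of_pos hc]
  rw [quasiTauSup]
  refine iSup_le fun x' => iSup_le fun hx => iSup_le fun y' => iSup_le fun hy => ?_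
  rw [one_div, ENNReal.rpow_inv_le_iff hp0, ENNReal.mul_rpow_of_nonneg _ _ hp0.le]
  have hu : ∀ i, ‖(c : 𝕜)⁻¹ • (x' i).comp (T i)‖ ≤ 1 := fun i => by
    rw [norm_smul, norm_inv, hcn, inv_mul_le_iff₀ hc, mul_one]
    exact (ContinuousLinearMap.opNorm_comp_le _ _).trans
      ((mul_le_mul (hx i) (hT i) (norm_nonneg _) zero_le_one).trans_eq (one_mul c))
  refine le_trans (le_of_eq ?_) (mul_le_mul_right (sum_enorm_rpow_le_quasiTauSup hp x y hu hy) _)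
  rw [Finset.mul_sum]
  refine Finset.sum_congr rfl fun j _ => ?_
  rw [← ENNReal.mul_rpow_of_nonneg _ _ hp0.le, show ENNReal.ofReal (c ^ n) = ‖(c : 𝕜) ^ n‖ₑ by
    rw [← ofReal_norm, norm_pow, hcn], ← enorm_mul, ← mul_assoc]
  congr 3
  simp only [smul_apply, smul_eq_mul, ContinuousLinearMap.comp_apply]
  rw [Finset.prod_mul_distrib, Finset.prod_const, Finset.card_univ, Fintype.card_fin, ← mul_assoc,
    ← mul_pow, mul_inv_cancel₀ hcK, one_pow, one_mul]

theorem IsQuasiTauBound.comp (hp : 1 ≤ p) {S : ContinuousMultilinearMap 𝕜 E (StrongDual 𝕜 F)}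
    {C : ℝ} (hS : IsQuasiTauBound p S C) {c : ℝ} (hc : 0 < c) {T : ∀ i, E i →L[𝕜] E i}
    (hT : ∀ i, ‖T i‖ ≤ c) : IsQuasiTauBound p (S.compContinuousLinearMap T) (C * c ^ n) := by
  refine ⟨mul_nonneg hS.1 (by positivity), fun m x y => ?_⟩
  rw [ENNReal.ofReal_mul hS.1, mul_assoc]
  exact (hS.2 m (fun j i => T i (x j i)) y).trans
    (mul_le_mul_right (quasiTauSup_comp_le hp hc hT x y) _)

theorem IsQuasiTauBound.sum_norm_rpow_le (hp : 1 ≤ p)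
    {S : ContinuousMultilinearMap 𝕜 (fun i => StrongDual 𝕜 (E i)) (StrongDual 𝕜 F)} {C : ℝ}
    (hS : IsQuasiTauBound p S C) (x' : ℕ → ∀ i, StrongDual 𝕜 (E i)) (y : ℕ → F)
    (hw : sigmaSup p x' y 0 ≠ ⊤) (N : ℕ) :
    ∑ j ∈ Finset.range N, ‖S (x' j) (y j)‖ ^ p ≤ (C * (sigmaSup p x' y 0).toReal) ^ p := by
  have hp0 : 0 < p := by linarith
  have hC := hS.1
  have h := (hS.2 N (fun j => x' j) (fun j => y j)).trans
    (mul_le_mul_right (quasiTauSup_le_sigmaSup hp x' y N) _)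
  rw [one_div, ENNReal.rpow_inv_le_iff hp0, ← ENNReal.ofReal_toReal hw, ← ENNReal.ofReal_mul hC,
    ENNReal.ofReal_rpow_of_nonneg (by positivity) hp0.le,
    Fin.sum_univ_eq_sum_range (fun j => ‖S (x' j) (y j)‖ₑ ^ p) N] at h
  rw [← ENNReal.ofReal_le_ofReal_iff (by positivity),
    ENNReal.ofReal_sum_of_nonneg (fun _ _ => by positivity)]
  refine le_trans (le_of_eq (Finset.sum_congr rfl fun j _ => ?_)) h
  rw [← ENNReal.ofReal_rpow_of_nonneg (norm_nonneg _) hp0.le, ofReal_norm]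

/-- Hölder's inequality. Applied to a representation it gives absolute convergence; applied to its
`tail` it gives the remainder estimates. -/
theorem IsQuasiTauBound.sum_norm_mul_le (hp : 1 ≤ p)
    {S : ContinuousMultilinearMap 𝕜 (fun i => StrongDual 𝕜 (E i)) (StrongDual 𝕜 F)} {C : ℝ}
    (hS : IsQuasiTauBound p S C) (l : lp (fun _ : ℕ => 𝕜) (conjExp p))
    (x' : ℕ → ∀ i, StrongDual 𝕜 (E i)) (y : ℕ → F)
    (hw : sigmaSup p x' y 0 ≠ ⊤) (N : ℕ) :
    ∑ j ∈ Finset.range N, ‖l j * S (x' j) (y j)‖ ≤ ‖l‖ * (C * (sigmaSup p x' y 0).toReal) := by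
  simp only [norm_mul]
  exact SigmaTau.sum_norm_mul_le hp l (fun j => S (x' j) (y j))
    (mul_nonneg hS.1 ENNReal.toReal_nonneg) (hS.sum_norm_rpow_le hp x' y hw) N

/-- The sequence `y` with its first `N` terms replaced by `0`. -/
def tail (N : ℕ) (y : ℕ → F) (j : ℕ) : F := if j < N then 0 else y j

theorem sigmaSup_tail_le (hp : 1 ≤ p) (x' : ℕ → ∀ i, StrongDual 𝕜 (E i)) (y : ℕ → F)
    (N m : ℕ) : sigmaSup p x' (tail N y) m ≤ sigmaSup p x' y m := by
  have hp0 : 0 < p := by linarith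
  refine sigmaSup_le hp fun x hx y' hy => le_trans ?_ (le_sigmaSup_rpow hp x' y m hx hy)
  refine ENNReal.tsum_le_tsum fun j => ?_
  unfold tail
  split_ifs <;> simp [hp0]

/-- Terms are set to zero rather than shifted away, so a remainder keeps the coefficients λ and the
functionals of the original representation, while its supremum drops to that of the terms from N on.
-/
theorem sigmaSup_tail_zero_le (hp : 1 ≤ p) (x' : ℕ → ∀ i, StrongDual 𝕜 (E i)) (y : ℕ → F)
    (N : ℕ) : sigmaSup p x' (tail N y) 0 ≤ sigmaSup p x' y N := by
  have hp0 : 0 < p := by linarith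
  refine sigmaSup_le hp fun x hx y' hy => le_trans ?_ (le_sigmaSup_rpow hp x' y N hx hy)
  rw [← ENNReal.summable.sum_add_tsum_nat_add' (k := N), Finset.sum_eq_zero, zero_add]
  · refine ENNReal.tsum_le_tsum fun j => ?_
    simp [tail]
  · intro j hj
    simp [tail, Finset.mem_range.1 hj, hp0]

/-- Stated for a general g because it serves both the sums of tensors and the scalar sums of λ_j
S(x'_j)(y_j). -/
theorem sum_range_tail {M : Type*} [AddCommGroup M] (g : ℕ → F → M) (hg : ∀ j, g j 0 = 0)
    (y : ℕ → F) {m N : ℕ} (h : m ≤ N) :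
    ∑ j ∈ Finset.range N, g j (tail m y j) =
      ∑ j ∈ Finset.range N, g j (y j) - ∑ j ∈ Finset.range m, g j (y j) := by
  rw [← Finset.sum_range_add_sum_Ico _ h, ← Finset.sum_range_add_sum_Ico (fun j => g j (y j)) h,
    add_sub_cancel_left, Finset.sum_eq_zero, zero_add]
  · refine Finset.sum_congr rfl fun j hj => ?_
    rw [tail, if_neg (Finset.mem_Ico.1 hj).1.not_gt]
  · intro j hj
    simp [tail, Finset.mem_range.1 hj, hg]

variable {A : ContinuousMultilinearMap 𝕜 E F} {l : lp (fun _ : ℕ => 𝕜) (conjExp p)}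
  {x' : ℕ → ∀ i, StrongDual 𝕜 (E i)} {y : ℕ → F}

/-- The remainder after the first `N` terms of a `σ(p)`-nuclear representation. -/
theorem IsSigmaRep.tail (hp : 1 ≤ p) (h : IsSigmaRep p A l x' y) (N : ℕ) :
    IsSigmaRep p (A - ∑ j ∈ Finset.range N, l j • elemTensor (x' j) (y j)) l x'
      (SigmaTau.tail N y) where
  tendsto_sum x := by
    have h1 := (h.tendsto_sum x).sub_const (∑ j ∈ Finset.range N, l j • elemTensor (x' j) (y j) x)
    have e : (A - ∑ j ∈ Finset.range N, l j • elemTensor (x' j) (y j)) x =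
        A x - ∑ j ∈ Finset.range N, l j • elemTensor (x' j) (y j) x := by
      rw [sub_apply, sum_apply]
      rfl
    rw [e]
    refine h1.congr' ?_
    filter_upwards [Filter.eventually_ge_atTop N] with M hM
    exact (sum_range_tail (fun j z => l j • elemTensor (x' j) z x) (fun j => by simp) y hM).symm
  sup_lt_top := (sigmaSup_tail_le hp x' y N 0).trans_lt h.sup_lt_top
  tendsto_tail := tendsto_of_tendsto_of_tendsto_of_le_of_le tendsto_const_nhds h.tendsto_tail
    (fun _ => zero_le) (fun m => sigmaSup_tail_le hp x' y N m)

theorem IsSigmaRep.sup_ne_top (hp : 1 ≤ p) (h : IsSigmaRep p A l x' y) (m : ℕ) :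
    sigmaSup p x' y m ≠ ⊤ :=
  ((sigmaSup_antitone hp x' y (Nat.zero_le m)).trans_lt h.sup_lt_top).ne

theorem IsSigmaRep.toReal_tail_le (hp : 1 ≤ p) (h : IsSigmaRep p A l x' y) (N : ℕ) :
    (sigmaSup p x' (SigmaTau.tail N y) 0).toReal ≤ (sigmaSup p x' y N).toReal :=
  ENNReal.toReal_mono (h.sup_ne_top hp N) (sigmaSup_tail_zero_le hp x' y N)

theorem IsSigmaRep.tendsto_toReal (h : IsSigmaRep p A l x' y) :
    Filter.Tendsto (fun m => (sigmaSup p x' y m).toReal) Filter.atTop (𝓝 0) := by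
  have := (ENNReal.tendsto_toReal ENNReal.zero_ne_top).comp h.tendsto_tail
  rwa [ENNReal.toReal_zero] at this

theorem IsSigmaRep.summable (hp : 1 ≤ p) (h : IsSigmaRep p A l x' y)
    {S : ContinuousMultilinearMap 𝕜 (fun i => StrongDual 𝕜 (E i)) (StrongDual 𝕜 F)} {C : ℝ}
    (hS : IsQuasiTauBound p S C) : Summable fun j => l j * S (x' j) (y j) :=
  Summable.of_norm <| summable_of_sum_range_le (fun _ => norm_nonneg _)
    (hS.sum_norm_mul_le hp l x' y h.sup_lt_top.ne)

/-- The bound does not depend on N, and S enters only through C; this uniformity is what allows S to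
be replaced by S ∘ T with varying T. -/
theorem IsSigmaRep.norm_sum_tail_le (hp : 1 ≤ p) (h : IsSigmaRep p A l x' y)
    {S : ContinuousMultilinearMap 𝕜 (fun i => StrongDual 𝕜 (E i)) (StrongDual 𝕜 F)} {C : ℝ}
    (hS : IsQuasiTauBound p S C) {m N : ℕ} (hmN : m ≤ N) :
    ‖∑ j ∈ Finset.range N, l j * S (x' j) (y j) - ∑ j ∈ Finset.range m, l j * S (x' j) (y j)‖ ≤
      ‖l‖ * (C * (sigmaSup p x' y m).toReal) := by
  rw [← sum_range_tail (fun j z => l j * S (x' j) z) (fun j => by simp) y hmN]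
  refine (norm_sum_le _ _).trans ((hS.sum_norm_mul_le hp l x' _ (h.tail hp m).sup_lt_top.ne N).trans
    ?_)
  exact mul_le_mul_of_nonneg_left (mul_le_mul_of_nonneg_left (h.toReal_tail_le hp m) hS.1)
    (lp.norm_nonneg' l)

/-- A representation of `0` vanishes also on the biduals. -/
theorem IsSigmaRep.norm_bidual_sum_le (hp : 1 ≤ p) (h : IsSigmaRep p 0 l x' y)
    {x'' : ∀ i, StrongDual 𝕜 (StrongDual 𝕜 (E i))} (hx : ∀ i, ‖x'' i‖ ≤ 1) (N : ℕ) :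
    ‖∑ j ∈ Finset.range N, (l j * ∏ i, x'' i (x' j i)) • y j‖ ≤
      ‖l‖ * (sigmaSup p x' y N).toReal := by
  rw [← Fin.sum_univ_eq_sum_range (fun j => (l j * ∏ i, x'' i (x' j i)) • y j) N]
  refine mem_of_forall_eval_mem (fun j : Fin N => x' j)
    (s := {z | ‖∑ j : Fin N, (l j * ∏ i, z i j) • y j‖ ≤ ‖l‖ * (sigmaSup p x' y N).toReal})
    (isClosed_le ?_ continuous_const) (fun x hx => ?_) hx
  · refine (continuous_finsetSum _ fun j _ => ?_).norm
    exact (continuous_const.mul (continuous_finsetProd _ fun i _ => by fun_prop)).smul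
      continuous_const
  -- Since the represented operator is 0, the remainder is minus the N-th partial sum.
  · have h1 := (h.tail hp N).norm_apply_le hp hx
    rw [zero_sub, neg_apply, norm_neg, sum_apply] at h1
    refine le_trans (le_of_eq ?_) (h1.trans
      (mul_le_mul_of_nonneg_left (h.toReal_tail_le hp N) (lp.norm_nonneg' l)))
    rw [← Fin.sum_univ_eq_sum_range (fun j => (l j • elemTensor (x' j) (y j)) x) N]
    congr 1
    refine Finset.sum_congr rfl fun j _ => ?_
    rw [smul_apply, elemTensor_apply, smul_smul]

theorem IsSigmaRep.tendsto_bidual_sum (hp : 1 ≤ p) (h : IsSigmaRep p 0 l x' y)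
    (x'' : ∀ i, StrongDual 𝕜 (StrongDual 𝕜 (E i))) :
    Filter.Tendsto (fun N => ∑ j ∈ Finset.range N, (l j * ∏ i, x'' i (x' j i)) • y j)
      Filter.atTop (𝓝 0) := by
  -- Each x''_i is scaled into the unit ball; the added 1 keeps the factor defined and nonzero when
  -- x''_i = 0.
  have h1 : ∀ i, ‖(((‖x'' i‖ + 1)⁻¹ : ℝ) : 𝕜) • x'' i‖ ≤ 1 := fun i => by
    rw [norm_smul, RCLike.norm_ofReal, abs_of_pos (by positivity), inv_mul_le_iff₀ (by positivity)]
    linarith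
  set d : 𝕜 := ∏ i, (((‖x'' i‖ + 1)⁻¹ : ℝ) : 𝕜) with hd
  have hd0 : d ≠ 0 := Finset.prod_ne_zero_iff.2 fun i _ => RCLike.ofReal_ne_zero.2 (by positivity)
  have h2 : Filter.Tendsto (fun N => ∑ j ∈ Finset.range N,
      (l j * ∏ i, ((((‖x'' i‖ + 1)⁻¹ : ℝ) : 𝕜) • x'' i) (x' j i)) • y j) Filter.atTop (𝓝 0) := by
    refine squeeze_zero_norm (fun N => h.norm_bidual_sum_le hp h1 N) ?_
    simpa using h.tendsto_toReal.const_mul ‖l‖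
  have h3 := h2.const_smul d⁻¹
  rw [smul_zero] at h3
  refine h3.congr fun N => ?_
  rw [Finset.smul_sum]
  refine Finset.sum_congr rfl fun j _ => ?_
  simp only [smul_apply, smul_eq_mul, Finset.prod_mul_distrib, smul_smul, ← hd]
  congr 1
  field_simp

end Estimates

end SigmaTau

namespace SigmaTau

/-! ### The functional induced by a quasi-τ(p)-summing operator is well defined. -/

section Extension

variable {𝕜 : Type w} [RCLike 𝕜] {n : ℕ} {E : Fin n → Type u} [∀ i, NormedAddCommGroup (E i)]
  [∀ i, NormedSpace 𝕜 (E i)] {F : Type v} [NormedAddCommGroup F] [NormedSpace 𝕜 F] {p : ℝ}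

/-- A bounded finite rank operator is a finite sum of operators of rank one. -/
theorem exists_eq_sum_smul_of_finiteDimensional_range {X : Type*} [NormedAddCommGroup X]
    [NormedSpace 𝕜 X] (T : X →L[𝕜] X) (hT : FiniteDimensional 𝕜 (LinearMap.range (T : X →ₗ[𝕜] X))) :
    ∃ (d : ℕ) (a : Fin d → StrongDual 𝕜 X) (e : Fin d → X), ∀ x, T x = ∑ k, a k x • e k := by
  let b := Module.finBasis 𝕜 (LinearMap.range (T : X →ₗ[𝕜] X))
  let R : X →L[𝕜] LinearMap.range (T : X →ₗ[𝕜] X) :=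
    T.codRestrict _ fun x => LinearMap.mem_range_self (T : X →ₗ[𝕜] X) x
  refine ⟨_, fun k => (LinearMap.toContinuousLinearMap (b.coord k)).comp R, fun k => b k,
    fun x => ?_⟩
  have := congrArg Subtype.val (b.sum_repr (R x))
  rw [AddSubmonoidClass.coe_finsetSum] at this
  exact this.symm

variable {A B : ContinuousMultilinearMap 𝕜 E F} {l : lp (fun _ : ℕ => 𝕜) (conjExp p)}
  {x' : ℕ → ∀ i, StrongDual 𝕜 (E i)} {y : ℕ → F}
  {S : ContinuousMultilinearMap 𝕜 (fun i => StrongDual 𝕜 (E i)) (StrongDual 𝕜 F)} {C : ℝ}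

/-- As T_i acts on E_i', its coordinate functionals a_{ik} lie in E_i''. Expanding S by
multilinearity gives a finite sum, over multi-indices r, of the functionals S(e_r) applied to bidual
sums, each of which tends to 0. -/
theorem IsSigmaRep.tendsto_sum_comp_finiteRank (hp : 1 ≤ p) (h : IsSigmaRep p 0 l x' y)
    (S : ContinuousMultilinearMap 𝕜 (fun i => StrongDual 𝕜 (E i)) (StrongDual 𝕜 F))
    (T : ∀ i, StrongDual 𝕜 (E i) →L[𝕜] StrongDual 𝕜 (E i))
    (hT : ∀ i, FiniteDimensional 𝕜
      (LinearMap.range (T i : StrongDual 𝕜 (E i) →ₗ[𝕜] StrongDual 𝕜 (E i)))) :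
    Filter.Tendsto (fun N => ∑ j ∈ Finset.range N, l j * S.compContinuousLinearMap T (x' j) (y j))
      Filter.atTop (𝓝 0) := by
  choose d a e hTe using fun i => exists_eq_sum_smul_of_finiteDimensional_range (T i) (hT i)
  have h1 := tendsto_finsetSum (Finset.univ : Finset (∀ i, Fin (d i))) fun r _ =>
    ((S fun i => e i (r i)).continuous.tendsto 0).comp
      (h.tendsto_bidual_sum hp fun i => a i (r i))
  simp only [map_zero, Finset.sum_const_zero] at h1
  refine h1.congr fun N => ?_
  simp only [Function.comp_apply, map_sum]
  rw [Finset.sum_comm]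
  refine Finset.sum_congr rfl fun j _ => ?_
  rw [ContinuousMultilinearMap.compContinuousLinearMap_apply]
  simp only [hTe]
  rw [S.map_sum, sum_apply, Finset.mul_sum]
  refine Finset.sum_congr rfl fun r _ => ?_
  rw [S.map_smul_univ, map_smul, smul_apply, smul_eq_mul, smul_eq_mul, mul_assoc]

/-- A bound for the partial sums of the image, under a quasi-`τ(p)`-summing operator, of a
representation of `0`. -/
theorem IsSigmaRep.norm_sum_le_of_eq_zero (hp : 1 ≤ p) (h : IsSigmaRep p 0 l x' y)
    (hS : IsQuasiTauBound p S C) {c : ℝ} (hc : 0 < c)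
    (happ : ∀ i, ∀ K : Set (StrongDual 𝕜 (E i)), IsCompact K → ∀ ε : ℝ, 0 < ε →
      ∃ T : StrongDual 𝕜 (E i) →L[𝕜] StrongDual 𝕜 (E i),
        FiniteDimensional 𝕜 (LinearMap.range (T : StrongDual 𝕜 (E i) →ₗ[𝕜] StrongDual 𝕜 (E i))) ∧
        ‖T‖ ≤ c ∧ ∀ x ∈ K, ‖T x - x‖ ≤ ε) (m : ℕ) :
    ‖∑ j ∈ Finset.range m, l j * S (x' j) (y j)‖ ≤
      ‖l‖ * (C * c ^ n * (sigmaSup p x' y m).toReal) := by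
  -- For fixed m only the finite, hence compact, sets of the first m functionals matter. The index ε
  -- is a natural number, and the accuracy is 1/(ε + 1).
  choose T hTfin hTc hT using fun (ε : ℕ) i => happ i _
    ((Finset.range m).finite_toSet.image fun j => x' j i).isCompact (1 / (ε + 1 : ℝ))
    Nat.one_div_pos_of_nat
  -- The whole series for S ∘ T k is 0, so its m-th partial sum is minus the tail from m on. The
  -- common bound c on the norms makes the estimate independent of k.
  have hbound : ∀ k, ‖∑ j ∈ Finset.range m, l j * S (fun i => T k i (x' j i)) (y j)‖ ≤
      ‖l‖ * (C * c ^ n * (sigmaSup p x' y m).toReal) := fun k => by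
    have h1 := ((h.tendsto_sum_comp_finiteRank hp S (T k) (hTfin k)).sub_const
      (∑ j ∈ Finset.range m, l j * S.compContinuousLinearMap (T k) (x' j) (y j))).norm
    rw [zero_sub, norm_neg] at h1
    refine le_of_tendsto h1 ?_
    filter_upwards [Filter.eventually_ge_atTop m] with N hN
    exact h.norm_sum_tail_le hp (hS.comp hp hc (hTc k)) hN
  refine le_of_tendsto (x := Filter.atTop) (Filter.Tendsto.norm ?_)
    (Filter.Eventually.of_forall hbound)
  refine tendsto_finsetSum _ fun j hj => Filter.Tendsto.const_mul _ ?_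
  have hlim : Filter.Tendsto (fun k i => T k i (x' j i)) Filter.atTop (𝓝 (x' j)) := by
    refine tendsto_pi_nhds.2 fun i => tendsto_iff_norm_sub_tendsto_zero.2 ?_
    exact squeeze_zero (fun _ => norm_nonneg _)
      (fun k => hT k i _ (Set.mem_image_of_mem (fun j => x' j i) (Finset.mem_coe.2 hj)))
      tendsto_one_div_add_atTop_nhds_zero_nat
  exact (((ContinuousLinearMap.apply 𝕜 𝕜 (y j)).continuous.comp S.cont).tendsto (x' j)).comp hlim

/-- The m-th partial sum is at most a constant times w_m, by finite rank approximation, and w_m → 0.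
This yields independence of the representation. -/
theorem IsSigmaRep.tendsto_sum_of_eq_zero (hp : 1 ≤ p) (h : IsSigmaRep p 0 l x' y)
    (hE : ∀ i, BoundedApproximationProperty 𝕜 (StrongDual 𝕜 (E i)))
    (hS : IsQuasiTauBound p S C) :
    Filter.Tendsto (fun N => ∑ j ∈ Finset.range N, l j * S (x' j) (y j)) Filter.atTop (𝓝 0) := by
  choose c hc using hE
  -- One constant for all the spaces; the summand 1 keeps it positive, even for n = 0.
  have hc0 : 0 < 1 + ∑ i, |c i| :=
    add_pos_of_pos_of_nonneg one_pos (Finset.sum_nonneg fun _ _ => abs_nonneg _)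
  have hle : ∀ i, c i ≤ 1 + ∑ i, |c i| := fun i => by
    have h1 := Finset.single_le_sum (f := fun i => |c i|) (fun _ _ => abs_nonneg _)
      (Finset.mem_univ i)
    have h2 := le_abs_self (c i)
    linarith
  refine squeeze_zero_norm (fun m => h.norm_sum_le_of_eq_zero hp hS hc0 ?_ m) ?_
  · intro i K hK ε hε
    obtain ⟨T, h1, h2, h3⟩ := hc i K hK ε hε
    exact ⟨T, h1, h2.trans (hle i), h3⟩
  · simpa using (h.tendsto_toReal.const_mul (C * (1 + ∑ i, |c i|) ^ n)).const_mul ‖l‖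

/-- `v` is the value at `A` of the functional induced by `S`, as computed from some representation
of `A`. -/
def IsBorelValue (p : ℝ) (S : ContinuousMultilinearMap 𝕜 (fun i => StrongDual 𝕜 (E i))
    (StrongDual 𝕜 F)) (A : ContinuousMultilinearMap 𝕜 E F) (v : 𝕜) : Prop :=
  ∃ l x' y, IsSigmaRep p A l x' y ∧
    Filter.Tendsto (fun N => ∑ j ∈ Finset.range N, l j * S (x' j) (y j)) Filter.atTop (𝓝 v)

theorem IsBorelValue.add (hp : 1 ≤ p) {v v' : 𝕜} (hA : IsBorelValue p S A v)
    (hB : IsBorelValue p S B v') : IsBorelValue p S (A + B) (v + v') := by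
  obtain ⟨l, x', y, h, ht⟩ := hA
  obtain ⟨k, u', z, h', ht'⟩ := hB
  -- The sum is represented by interleaving, so its partial sums split into partial sums of the two
  -- series, of lengths (N + 1) / 2 and N / 2.
  refine ⟨_, _, _, h.add hp h', ?_⟩
  have t1 : Filter.Tendsto (fun N : ℕ => (N + 1) / 2) Filter.atTop Filter.atTop :=
    Filter.tendsto_atTop.2 fun b => Filter.eventually_atTop.2 ⟨2 * b, fun a ha => by omega⟩
  have t2 : Filter.Tendsto (fun N : ℕ => N / 2) Filter.atTop Filter.atTop :=
    Filter.tendsto_atTop.2 fun b => Filter.eventually_atTop.2 ⟨2 * b, fun a ha => by omega⟩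
  refine ((ht.comp t1).add (ht'.comp t2)).congr fun N => ?_
  refine (sum_interleave _ _ _ (fun j => ?_) (fun j => ?_) N).symm
  · simp only [interleave_even]
  · simp only [interleave_odd]

theorem IsBorelValue.smul (hp : 1 ≤ p) {v : 𝕜} (hA : IsBorelValue p S A v) (c : 𝕜) :
    IsBorelValue p S (c • A) (c * v) := by
  obtain ⟨l, x', y, h, ht⟩ := hA
  have h1 := h.scale hp c 1
  rw [mul_one, one_smul] at h1
  refine ⟨_, _, _, h1, (ht.const_mul c).congr fun N => ?_⟩
  rw [Finset.mul_sum]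
  refine Finset.sum_congr rfl fun j _ => ?_
  rw [lp.coeFn_smul, Pi.smul_apply, smul_eq_mul, mul_assoc]

/-- The difference of two representations of A is a representation of 0. -/
theorem IsBorelValue.unique (hp : 1 ≤ p)
    (hE : ∀ i, BoundedApproximationProperty 𝕜 (StrongDual 𝕜 (E i)))
    (hS : IsQuasiTauBound p S C) {v v' : 𝕜} (hv : IsBorelValue p S A v)
    (hv' : IsBorelValue p S A v') : v = v' := by
  obtain ⟨l, x', y, h, ht⟩ := hv.add hp (hv'.smul hp (-1))
  rw [neg_one_smul, add_neg_cancel] at h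
  have := tendsto_nhds_unique ht (h.tendsto_sum_of_eq_zero hp hE hS)
  rwa [neg_one_mul, ← sub_eq_add_neg, sub_eq_zero] at this

theorem IsSigmaRep.exists_tendsto (hp : 1 ≤ p) (h : IsSigmaRep p A l x' y)
    (hS : IsQuasiTauBound p S C) : ∃ v, ‖v‖ ≤ C * (‖l‖ * (sigmaSup p x' y 0).toReal) ∧
      Filter.Tendsto (fun N => ∑ j ∈ Finset.range N, l j * S (x' j) (y j)) Filter.atTop (𝓝 v) := by
  have ht := (h.summable hp hS).hasSum.tendsto_sum_nat
  refine ⟨_, le_of_tendsto ht.norm (Filter.Eventually.of_forall fun N => ?_), ht⟩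
  refine (norm_sum_le _ _).trans ((hS.sum_norm_mul_le hp l x' y h.sup_lt_top.ne N).trans_eq ?_)
  ring

/-- By uniqueness the value may be computed from a nearly optimal representation, whatever
representation produced v. -/
theorem IsBorelValue.norm_le (hp : 1 ≤ p)
    (hE : ∀ i, BoundedApproximationProperty 𝕜 (StrongDual 𝕜 (E i)))
    (hS : IsQuasiTauBound p S C) {v : 𝕜} (hv : IsBorelValue p S A v) :
    ‖v‖ ≤ C * sigmaNorm p A := by
  have hA : IsSigmaNuclear p A := by
    obtain ⟨l, x', y, h, -⟩ := hv
    exact ⟨l, x', y, h⟩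
  refine le_of_tendsto_of_tendsto (f := fun _ : ℝ => ‖v‖)
    (g := fun s => C * s) (b := 𝓝[>] (sigmaNorm p A)) tendsto_const_nhds
    (((continuous_const_mul C).tendsto _).mono_left nhdsWithin_le_nhds) ?_
  filter_upwards [self_mem_nhdsWithin] with s hs
  obtain ⟨l, x', y, h, hlt⟩ := hA.exists_lt hs
  obtain ⟨v', hv', ht⟩ := h.exists_tendsto hp hS
  rw [hv.unique hp hE hS ⟨l, x', y, h, ht⟩]
  exact hv'.trans (mul_le_mul_of_nonneg_left hlt.le hS.1)

theorem isBorelValue_elemTensor (hp : 1 ≤ p)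
    (S : ContinuousMultilinearMap 𝕜 (fun i => StrongDual 𝕜 (E i)) (StrongDual 𝕜 F))
    (x' : ∀ i, StrongDual 𝕜 (E i)) (y : F) : IsBorelValue p S (elemTensor x' y) (S x' y) := by
  refine ⟨_, _, _, isSigmaRep_elemTensor hp x' y, tendsto_const_nhds.congr' ?_⟩
  filter_upwards [Filter.eventually_ge_atTop 1] with N hN
  rw [Finset.sum_eq_single_of_mem 0 (Finset.mem_range.2 hN) fun j _ hj => by simp [hj]]
  simp

end Extension

/-! ### Surjectivity of the Borel transform, and the bound of ‖φ‖ by any admissible constant. -/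

section Borel

variable {𝕜 : Type w} [RCLike 𝕜] (p : ℝ) [Fact (1 ≤ p)] {n : ℕ} {E : Fin n → Type u}
  [∀ i, NormedAddCommGroup (E i)] [∀ i, NormedSpace 𝕜 (E i)] {F : Type v} [NormedAddCommGroup F]
  [NormedSpace 𝕜 F]

theorem exists_borelTransform_eq
    (hE : ∀ i, BoundedApproximationProperty 𝕜 (StrongDual 𝕜 (E i)))
    {S : ContinuousMultilinearMap 𝕜 (fun i => StrongDual 𝕜 (E i)) (StrongDual 𝕜 F)}
    (hS : IsQuasiTau p S) :
    ∃ φ : StrongDual 𝕜 (SigmaNuclear 𝕜 p E F), borelTransform p φ = S := by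
  have hp : 1 ≤ p := Fact.out
  obtain ⟨C, hC⟩ := hS
  have hex : ∀ A : SigmaNuclear 𝕜 p E F, ∃ v, IsBorelValue p S A.1 v := fun A => by
    obtain ⟨l, x', y, h⟩ := A.2
    obtain ⟨v, -, ht⟩ := h.exists_tendsto hp hC
    exact ⟨v, l, x', y, h, ht⟩
  -- The representations are chosen arbitrarily; uniqueness of the value then forces additivity,
  -- homogeneity and the value S(x')(y) on tensors.
  choose f hf using hex
  refine ⟨LinearMap.mkContinuous
    { toFun := f
      map_add' := fun A B => (hf (A + B)).unique hp hE hC ((hf A).add hp (hf B))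
      map_smul' := fun c A => (hf (c • A)).unique hp hE hC ((hf A).smul hp c) } C
    fun A => (hf A).norm_le hp hE hC, ?_⟩
  ext x' y
  exact (hf (SigmaNuclear.tensor p x' y)).unique hp hE hC (isBorelValue_elemTensor hp S x' y)

variable {p}

/-- The remainder has σ(p)-norm at most ‖λ‖ w_N: this is the role of the condition w_m → 0. Hence a
bounded functional is determined by its Borel transform. -/
theorem SigmaNuclear.tendsto_sum_tensor {A : SigmaNuclear 𝕜 p E F}
    {l : lp (fun _ : ℕ => 𝕜) (conjExp p)} {x' : ℕ → ∀ i, StrongDual 𝕜 (E i)} {y : ℕ → F}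
    (h : IsSigmaRep p A.1 l x' y) :
    Filter.Tendsto (fun N => ∑ j ∈ Finset.range N, l j • SigmaNuclear.tensor p (x' j) (y j))
      Filter.atTop (𝓝 A) := by
  have hp : 1 ≤ p := Fact.out
  refine tendsto_iff_norm_sub_tendsto_zero.2 ?_
  have h1 := h.tendsto_toReal.const_mul ‖l‖
  rw [mul_zero] at h1
  refine squeeze_zero (fun _ => norm_nonneg _) (fun N => ?_) h1
  rw [norm_sub_rev]
  have e : (A - ∑ j ∈ Finset.range N, l j • SigmaNuclear.tensor p (x' j) (y j)).1 =
      A.1 - ∑ j ∈ Finset.range N, l j • elemTensor (x' j) (y j) := by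
    have := map_sum (sigmaNuclearSubmodule 𝕜 p E F).subtype
      (fun j => l j • SigmaNuclear.tensor p (x' j) (y j)) (Finset.range N)
    exact congrArg (A.1 - ·) this
  show sigmaNorm p (A - ∑ j ∈ Finset.range N, l j • SigmaNuclear.tensor p (x' j) (y j)).1 ≤ _
  rw [e]
  exact (sigmaNorm_le (h.tail hp N)).trans
    (mul_le_mul_of_nonneg_left (h.toReal_tail_le hp N) (lp.norm_nonneg' l))

theorem norm_le_of_isQuasiTauBound {φ : StrongDual 𝕜 (SigmaNuclear 𝕜 p E F)} {C : ℝ}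
    (hC : IsQuasiTauBound p (borelTransform p φ) C) : ‖φ‖ ≤ C := by
  have hp : 1 ≤ p := Fact.out
  refine φ.opNorm_le_bound hC.1 fun A => ?_
  refine le_of_tendsto_of_tendsto (f := fun _ : ℝ => ‖φ A‖)
    (g := fun s => C * s) (b := 𝓝[>] ‖A‖) tendsto_const_nhds
    (((continuous_const_mul C).tendsto _).mono_left nhdsWithin_le_nhds) ?_
  filter_upwards [self_mem_nhdsWithin] with s hs
  obtain ⟨l, x', y, h, hlt⟩ := IsSigmaNuclear.exists_lt A.2 hs
  obtain ⟨v, hv, ht⟩ := h.exists_tendsto hp hC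
  have h1 := (φ.continuous.tendsto A).comp (SigmaNuclear.tendsto_sum_tensor h)
  have h2 : φ A = v := by
    refine tendsto_nhds_unique h1 (ht.congr fun N => ?_)
    simp only [Function.comp_apply, map_sum, map_smul, smul_eq_mul, borelTransform_apply]
  rw [h2]
  exact hv.trans (mul_le_mul_of_nonneg_left hlt.le hC.1)

end Borel

end SigmaTau

namespace SigmaTau

/-! ### Admissibility of ‖φ‖ for the Borel transform, and the isometry. -/

section Borel

variable {𝕜 : Type w} [RCLike 𝕜] {p : ℝ} {n : ℕ} {E : Fin n → Type u}
  [∀ i, NormedAddCommGroup (E i)] [∀ i, NormedSpace 𝕜 (E i)] {F : Type v} [NormedAddCommGroup F]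
  [NormedSpace 𝕜 F]

/-- A finitely supported element of `ℓ_{p'}` that norms the first `m` terms of a sequence. -/
theorem exists_lp_norming (hp : 1 ≤ p) (m : ℕ) (a : ℕ → 𝕜) :
    ∃ l : lp (fun _ : ℕ => 𝕜) (conjExp p),
      ‖l‖ ≤ (∑ j ∈ Finset.range m, ‖a j‖ ^ p) ^ (1 - 1 / p) ∧
      ∀ j < m, l j * a j = ((‖a j‖ ^ p : ℝ) : 𝕜) := by
  have hp0 : 0 < p := by linarith
  choose c hc1 hc2 using fun j => RCLike.exists_norm_eq_mul_self (a j)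
  -- The extremal case of Hölder: modulus ‖a_j‖^(p-1), with the phase that makes f_j a_j = ‖a_j‖^p.
  -- For p > 1, (p - 1)p' = p.
  set f : ℕ → 𝕜 := fun j => if j < m then c j * ((‖a j‖ ^ (p - 1) : ℝ) : 𝕜) else 0 with hf
  have hfn : ∀ j < m, ‖f j‖ = ‖a j‖ ^ (p - 1) := fun j hj => by
    rw [hf]
    simp only [if_pos hj]
    rw [norm_mul, hc1, one_mul, RCLike.norm_ofReal, abs_of_nonneg (by positivity)]
  have hf0 : ∀ j, ¬ j < m → f j = 0 := fun j hj => by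
    rw [hf]
    simp only [if_neg hj]
  have hmem : Memℓp (E := fun _ : ℕ => 𝕜) f (conjExp p) := by
    refine (memℓp_zero ((Finset.range m).finite_toSet.subset fun j hj => ?_)).of_exponent_ge
      (zero_le)
    by_contra h
    exact hj (hf0 j (by simpa using h))
  refine ⟨⟨f, hmem⟩, ?_, fun j hj => ?_⟩
  · rcases hp.eq_or_lt with rfl | hp
    -- `conjExp 1` equals ⊤ only by a theorem, and the type of f depends on it; a variable exponent
    -- q allows the substitution.
    · have key : ∀ q : ℝ≥0∞, q = ⊤ → ∀ f : lp (fun _ : ℕ => 𝕜) q, (∀ j, ‖f j‖ ≤ 1) → ‖f‖ ≤ 1 := by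
        rintro q rfl f hf
        exact lp.norm_le_of_forall_le zero_le_one hf
      rw [show (1 : ℝ) - 1 / 1 = 0 by norm_num, Real.rpow_zero]
      refine key _ conjExp_one _ fun j => ?_
      show ‖f j‖ ≤ 1
      by_cases hj : j < m
      · rw [hfn j hj, sub_self, Real.rpow_zero]
      · rw [hf0 j hj, norm_zero]
        exact zero_le_one
    · have hh := holder_conjExp hp
      have hq := hh.symm.pos
      have e : 1 - 1 / p = 1 / (conjExp p).toReal := by
        have := hh.inv_add_inv_eq_one
        rw [one_div, one_div]; linarith
      have hM : 0 ≤ ∑ j ∈ Finset.range m, ‖a j‖ ^ p := by positivity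
      refine lp.norm_le_of_tsum_le hq (by positivity) ?_
      rw [e, ← Real.rpow_mul hM, one_div_mul_cancel hq.ne', Real.rpow_one]
      show ∑' j, ‖f j‖ ^ (conjExp p).toReal ≤ _
      rw [tsum_eq_sum (s := Finset.range m) fun j hj => by
        rw [hf0 j (by simpa using hj), norm_zero, Real.zero_rpow hq.ne']]
      refine le_of_eq (Finset.sum_congr rfl fun j hj => ?_)
      rw [hfn j (Finset.mem_range.1 hj), ← Real.rpow_mul (norm_nonneg _), hh.sub_one_mul_conj]
  · show f j * a j = _
    rw [hf]
    simp only [if_pos hj]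
    rw [mul_right_comm, ← hc2, ← RCLike.ofReal_mul]
    congr 1
    rcases (norm_nonneg (a j)).eq_or_lt with h | h
    · rw [← h, zero_mul, Real.zero_rpow hp0.ne']
    · rw [← Real.rpow_one_add' h.le (by linarith)]
      congr 1
      ring

theorem sigmaSup_lt_top_of_finite (hp : 1 ≤ p) (x' : ℕ → ∀ i, StrongDual 𝕜 (E i)) {y : ℕ → F}
    {m : ℕ} (hy : ∀ j, m ≤ j → y j = 0) : sigmaSup p x' y 0 < ⊤ := by
  have hp0 : 0 < p := by linarith
  have hfin : (∑ j ∈ Finset.range m, ENNReal.ofReal ((∏ i, ‖x' j i‖) * ‖y j‖) ^ p) ≠ ⊤ :=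
    ENNReal.sum_ne_top.2 fun j _ => (ENNReal.rpow_lt_top_of_nonneg hp0.le ENNReal.ofReal_ne_top).ne
  refine lt_of_le_of_lt (sigmaSup_le hp fun x hx y' hy' => ?_)
    (ENNReal.rpow_lt_top_of_nonneg (y := 1 / p) (by positivity) hfin)
  rw [← ENNReal.rpow_mul, one_div_mul_cancel hp0.ne', ENNReal.rpow_one,
    tsum_eq_sum (s := Finset.range m) fun j hj => by
      rw [add_zero, hy j (by simpa using hj), map_zero, mul_zero, enorm_zero,
        ENNReal.zero_rpow_of_pos hp0]]
  refine Finset.sum_le_sum fun j _ => ENNReal.rpow_le_rpow ?_ hp0.le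
  rw [← ofReal_norm]
  exact ENNReal.ofReal_le_ofReal (norm_prod_mul_le
    (fun i => norm_apply_le_of_le_one _ (hx i)) (norm_apply_le_of_norm_le_one hy' _))

theorem sigmaSup_eq_zero (hp : 1 ≤ p) (x' : ℕ → ∀ i, StrongDual 𝕜 (E i)) {y : ℕ → F}
    {m : ℕ} (hy : ∀ j, m ≤ j → y j = 0) : sigmaSup p x' y m = 0 := by
  have hp0 : 0 < p := by linarith
  refine nonpos_iff_eq_zero.1 (sigmaSup_le hp fun x hx y' hy' => ?_)
  simp [hy, hp0]

theorem isSigmaRep_of_finite (hp : 1 ≤ p) (l : lp (fun _ : ℕ => 𝕜) (conjExp p))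
    (x' : ℕ → ∀ i, StrongDual 𝕜 (E i)) {y : ℕ → F} {m : ℕ} (hy : ∀ j, m ≤ j → y j = 0) :
    IsSigmaRep p (∑ j ∈ Finset.range m, l j • elemTensor (x' j) (y j)) l x' y where
  tendsto_sum x := by
    refine tendsto_const_nhds.congr' ?_
    filter_upwards [Filter.eventually_ge_atTop m] with N hN
    rw [sum_apply]
    refine Finset.sum_subset (Finset.range_mono hN) fun j _ hj => ?_
    simp [hy j (by simpa using hj)]
  sup_lt_top := sigmaSup_lt_top_of_finite hp x' hy
  tendsto_tail := by
    refine tendsto_const_nhds.congr' ?_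
    filter_upwards [Filter.eventually_ge_atTop m] with N hN
    exact (sigmaSup_eq_zero hp x' fun j hj => hy j (hN.trans hj)).symm

/-- The canonical embedding maps the ball of E_i into that of E_i'', so the supremum on the right
has more test points. -/
theorem sigmaSup_le_quasiTauSup (hp : 1 ≤ p) (x' : ℕ → ∀ i, StrongDual 𝕜 (E i)) {y : ℕ → F}
    {m : ℕ} (hy : ∀ j, m ≤ j → y j = 0) :
    sigmaSup p x' y 0 ≤ quasiTauSup 𝕜 p (fun j : Fin m => x' j) (fun j => y j) := by
  have hp0 : 0 < p := by linarith
  refine sigmaSup_le hp fun x hx y' hy' => ?_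
  have h := sum_enorm_rpow_le_quasiTauSup hp (fun j : Fin m => x' j) (fun j => y j)
    (x' := fun i => NormedSpace.inclusionInDoubleDual 𝕜 (E i) (x i))
    (fun i => (NormedSpace.double_dual_bound 𝕜 (E i) (x i)).trans (hx i)) hy'
  refine le_trans (le_of_eq ?_) h
  rw [tsum_eq_sum (s := Finset.range m) fun j hj => by
      rw [add_zero, hy j (by simpa using hj), map_zero, mul_zero, enorm_zero,
        ENNReal.zero_rpow_of_pos hp0]]
  exact (Fin.sum_univ_eq_sum_range (fun j => ‖(∏ i, x' j i (x i)) * y' (y j)‖ₑ ^ p) m).symm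

/-- With a_j = φ(x'_j ⊗ y_j) and M = ∑ ‖a_j‖^p, the norming λ gives φ(∑ λ_j x'_j ⊗ y_j) = M, while
the argument has σ(p)-norm at most M^(1-1/p) w_0. Dividing by M^(1-1/p) leaves M^(1/p) ≤ ‖φ‖ w_0. -/
theorem isQuasiTauBound_borelTransform [Fact (1 ≤ p)] (φ : StrongDual 𝕜 (SigmaNuclear 𝕜 p E F)) :
    IsQuasiTauBound p (borelTransform p φ) ‖φ‖ := by
  have hp : 1 ≤ p := Fact.out
  have hp0 : 0 < p := by linarith
  refine ⟨norm_nonneg φ, fun m x z => ?_⟩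
  -- The finite families are extended by 0 to sequences; the vanishing of y from m on is what makes
  -- w_0 finite and bounded by the finite supremum.
  obtain ⟨x', hx⟩ : ∃ x' : ℕ → ∀ i, StrongDual 𝕜 (E i), x = fun j : Fin m => x' j :=
    ⟨fun j => if h : j < m then x ⟨j, h⟩ else 0, by ext j : 1; simp⟩
  obtain ⟨y, hy, hz⟩ : ∃ y : ℕ → F, (∀ j, m ≤ j → y j = 0) ∧ z = fun j : Fin m => y j :=
    ⟨fun j => if h : j < m then z ⟨j, h⟩ else 0, fun j hj => by simp [hj.not_gt],
      by ext j : 1; simp⟩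
  subst hx hz
  set a : ℕ → 𝕜 := fun j => borelTransform p φ (x' j) (y j) with ha
  set M : ℝ := ∑ j ∈ Finset.range m, ‖a j‖ ^ p with hM
  have hM0 : 0 ≤ M := by positivity
  obtain ⟨l, hl, hla⟩ := exists_lp_norming hp m a
  have hrep := isSigmaRep_of_finite hp l x' hy
  set W := (sigmaSup p x' y 0).toReal with hW
  have hW0 : 0 ≤ W := ENNReal.toReal_nonneg
  have hMle : M ≤ ‖φ‖ * (M ^ (1 - 1 / p) * W) := by
    have e1 : φ (∑ j ∈ Finset.range m, l j • SigmaNuclear.tensor p (x' j) (y j)) = (M : 𝕜) := by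
      rw [map_sum, hM, RCLike.ofReal_sum]
      refine Finset.sum_congr rfl fun j hj => ?_
      rw [map_smul, smul_eq_mul]
      exact hla j (Finset.mem_range.1 hj)
    have e2 : ‖∑ j ∈ Finset.range m, l j • SigmaNuclear.tensor p (x' j) (y j)‖ ≤ ‖l‖ * W := by
      have e3 := map_sum (sigmaNuclearSubmodule 𝕜 p E F).subtype
        (fun j => l j • SigmaNuclear.tensor p (x' j) (y j)) (Finset.range m)
      refine le_trans (le_of_eq ?_) (sigmaNorm_le hrep)
      exact congrArg (sigmaNorm p) e3
    have h := φ.le_opNorm (∑ j ∈ Finset.range m, l j • SigmaNuclear.tensor p (x' j) (y j))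
    rw [e1, RCLike.norm_ofReal, abs_of_nonneg hM0] at h
    exact h.trans (mul_le_mul_of_nonneg_left
      (e2.trans (mul_le_mul_of_nonneg_right hl hW0)) (norm_nonneg φ))
  have hfinal : M ^ (1 / p) ≤ ‖φ‖ * W := by
    rcases hM0.eq_or_lt with h | h
    · rw [← h, Real.zero_rpow (by positivity)]
      positivity
    · have h1 : M = M ^ (1 / p) * M ^ (1 - 1 / p) := by
        rw [← Real.rpow_add h, add_sub_cancel, Real.rpow_one]
      refine le_of_mul_le_mul_right ?_ (Real.rpow_pos_of_pos h (1 - 1 / p))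
      rw [← h1]
      exact hMle.trans_eq (by ring)
  refine le_trans ?_ (mul_le_mul_right (sigmaSup_le_quasiTauSup hp x' hy) _)
  rw [← ENNReal.ofReal_toReal hrep.sup_lt_top.ne, ← ENNReal.ofReal_mul (norm_nonneg φ)]
  refine le_trans (le_of_eq ?_) (ENNReal.ofReal_le_ofReal hfinal)
  rw [← ENNReal.ofReal_rpow_of_nonneg hM0 (by positivity), hM,
    ENNReal.ofReal_sum_of_nonneg (fun _ _ => by positivity),
    Fin.sum_univ_eq_sum_range (fun j => ‖a j‖ₑ ^ p) m]
  congr 1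
  refine Finset.sum_congr rfl fun j _ => ?_
  rw [← ENNReal.ofReal_rpow_of_nonneg (norm_nonneg _) hp0.le, ofReal_norm]

variable (p) [Fact (1 ≤ p)]

/-- The Borel transform, as a linear isometry into the quasi-`τ(p)`-summing operators. -/
noncomputable def borelIsometry : StrongDual 𝕜 (SigmaNuclear 𝕜 p E F) →ₗᵢ[𝕜]
    QuasiTau 𝕜 p (fun i => StrongDual 𝕜 (E i)) F where
  toFun φ := ⟨borelTransform p φ, _, isQuasiTauBound_borelTransform φ⟩
  map_add' φ ψ := Subtype.ext (by ext x' y; rfl)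
  map_smul' c φ := Subtype.ext (by ext x' y; rfl)
  norm_map' φ := by
    refine le_antisymm (quasiTauNorm_le (isQuasiTauBound_borelTransform φ)) ?_
    exact le_csInf ⟨_, isQuasiTauBound_borelTransform φ⟩ fun C hC => norm_le_of_isQuasiTauBound hC

theorem exists_borelEquiv (hE : ∀ i, BoundedApproximationProperty 𝕜 (StrongDual 𝕜 (E i))) :
    ∃ Φ : StrongDual 𝕜 (SigmaNuclear 𝕜 p E F) ≃ₗᵢ[𝕜]
        QuasiTau 𝕜 p (fun i => StrongDual 𝕜 (E i)) F,
      ∀ φ, (Φ φ).toMultilinear p = borelTransform p φ := by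
  refine ⟨LinearIsometryEquiv.ofSurjective (borelIsometry p) fun S => ?_, fun φ => rfl⟩
  obtain ⟨φ, hφ⟩ := exists_borelTransform_eq p hE S.2
  exact ⟨φ, Subtype.ext hφ⟩

end Borel

/-! ### The linear case, by transport from n = 1. -/

section Linear

variable (𝕜 : Type w) [RCLike 𝕜] (p : ℝ) [Fact (1 ≤ p)] (E : Type u)
  [NormedAddCommGroup E] [NormedSpace 𝕜 E] (F : Type v) [NormedAddCommGroup F] [NormedSpace 𝕜 F]

/-- `𝓛_{σ(p)}(E; F)` is isometric to the space of `σ(p)`-nuclear `1`-linear operators. -/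
noncomputable def SigmaNuclearOp.equiv :
    SigmaNuclearOp 𝕜 p E F ≃ₗᵢ[𝕜] SigmaNuclear 𝕜 p (fun _ : Fin 1 => E) F :=
  LinearIsometryEquiv.ofSurjective
    { toLinearMap := SigmaNuclearOp.incl 𝕜 p E F
      norm_map' := fun _ => rfl }
    fun A => ⟨⟨(toOneLinear 𝕜 E F).symm A.1, by
      show IsSigmaNuclear p (toOneLinear 𝕜 E F ((toOneLinear 𝕜 E F).symm A.1))
      rw [LinearIsometryEquiv.apply_symm_apply]
      exact A.2⟩, Subtype.ext ((toOneLinear 𝕜 E F).apply_symm_apply A.1)⟩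

/-- `𝓛_{qτ(p)}(E; F')` is isometric to the space of quasi-`τ(p)`-summing `1`-linear operators. -/
noncomputable def QuasiTauOp.equiv :
    QuasiTauOp 𝕜 p E F ≃ₗᵢ[𝕜] QuasiTau 𝕜 p (fun _ : Fin 1 => E) F :=
  LinearIsometryEquiv.ofSurjective
    { toLinearMap := QuasiTauOp.incl 𝕜 p E F
      norm_map' := fun _ => rfl }
    fun A => ⟨⟨(toOneLinear 𝕜 E (StrongDual 𝕜 F)).symm A.1, by
      show IsQuasiTau p (toOneLinear 𝕜 E (StrongDual 𝕜 F)
        ((toOneLinear 𝕜 E (StrongDual 𝕜 F)).symm A.1))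
      rw [LinearIsometryEquiv.apply_symm_apply]
      exact A.2⟩, Subtype.ext ((toOneLinear 𝕜 E (StrongDual 𝕜 F)).apply_symm_apply A.1)⟩

variable {𝕜 E F}

/-- A linear isometric isomorphism induces one of the duals. -/
noncomputable def dualCongr {X Y : Type*} [NormedAddCommGroup X] [NormedSpace 𝕜 X]
    [NormedAddCommGroup Y] [NormedSpace 𝕜 Y] (e : X ≃ₗᵢ[𝕜] Y) :
    StrongDual 𝕜 X ≃ₗᵢ[𝕜] StrongDual 𝕜 Y where
  toLinearEquiv := (e.toContinuousLinearEquiv.arrowCongr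
    (ContinuousLinearEquiv.refl 𝕜 𝕜)).toLinearEquiv
  norm_map' f := f.opNorm_comp_linearIsometryEquiv e.symm

theorem SigmaNuclearOp.equiv_tensor (x' : StrongDual 𝕜 E) (y : F) :
    SigmaNuclearOp.equiv 𝕜 p E F (SigmaNuclearOp.tensor p x' y) =
      SigmaNuclear.tensor p (fun _ => x') y := by
  refine Subtype.ext ?_
  show toOneLinear 𝕜 E F (x'.smulRight y) = elemTensor (fun _ : Fin 1 => x') y
  ext x
  simp [toOneLinear]

theorem QuasiTauOp.toLin_equiv_symm (S : QuasiTau 𝕜 p (fun _ : Fin 1 => E) F) (x : E) :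
    ((QuasiTauOp.equiv 𝕜 p E F).symm S).toLin p x = S.toMultilinear p fun _ => x := by
  obtain ⟨u, rfl⟩ := (QuasiTauOp.equiv 𝕜 p E F).surjective S
  rw [LinearIsometryEquiv.symm_apply_apply]
  rfl

/-- The 1-linear case conjugated by the isometric identifications of operators with 1-linear maps;
these take x' ⊗ y to x' ⊗ y, so the formula for the Borel transform is preserved. -/
theorem exists_borelEquiv_op (hE : BoundedApproximationProperty 𝕜 (StrongDual 𝕜 E)) :
    ∃ Ψ : StrongDual 𝕜 (SigmaNuclearOp 𝕜 p E F) ≃ₗᵢ[𝕜] QuasiTauOp 𝕜 p (StrongDual 𝕜 E) F,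
      ∀ (φ : StrongDual 𝕜 (SigmaNuclearOp 𝕜 p E F)) (x' : StrongDual 𝕜 E) (y : F),
        (Ψ φ).toLin p x' y = φ (SigmaNuclearOp.tensor p x' y) := by
  obtain ⟨Φ, hΦ⟩ := exists_borelEquiv p (E := fun _ : Fin 1 => E) (F := F) fun _ => hE
  let D := dualCongr (SigmaNuclearOp.equiv 𝕜 p E F)
  refine ⟨(D.trans Φ).trans (QuasiTauOp.equiv 𝕜 p (StrongDual 𝕜 E) F).symm, fun φ x' y => ?_⟩
  have h1 := QuasiTauOp.toLin_equiv_symm p (Φ (D φ)) x'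
  rw [hΦ] at h1
  refine (congrArg (fun g : StrongDual 𝕜 F => g y) h1).trans ?_
  show φ ((SigmaNuclearOp.equiv 𝕜 p E F).symm (SigmaNuclear.tensor p (fun _ => x') y)) = _
  rw [← SigmaNuclearOp.equiv_tensor, LinearIsometryEquiv.symm_apply_apply]

end Linear

end SigmaTau

theorem theorem3p2 {𝕜 : Type w} [RCLike 𝕜] (p : ℝ) [Fact (1 ≤ p)] :
    -- the `n`-linear case: the Borel transform, with values in the quasi-`τ(p)`-summing operators,
    -- is a linear isometric bijection
    (∀ (n : ℕ) (E : Fin n → Type u) [∀ i, NormedAddCommGroup (E i)] [∀ i, NormedSpace 𝕜 (E i)]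
        [∀ i, CompleteSpace (E i)] (F : Type v) [NormedAddCommGroup F] [NormedSpace 𝕜 F]
        [CompleteSpace F],
      (∀ i, SigmaTau.BoundedApproximationProperty 𝕜 (StrongDual 𝕜 (E i))) →
      ∃ Φ : StrongDual 𝕜 (SigmaTau.SigmaNuclear 𝕜 p E F) ≃ₗᵢ[𝕜]
          SigmaTau.QuasiTau 𝕜 p (fun i => StrongDual 𝕜 (E i)) F,
        ∀ φ, (Φ φ).toMultilinear p = SigmaTau.borelTransform p φ) ∧
    -- the linear case
    (∀ (E : Type u) [NormedAddCommGroup E] [NormedSpace 𝕜 E] [CompleteSpace E]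
        (F : Type v) [NormedAddCommGroup F] [NormedSpace 𝕜 F] [CompleteSpace F],
      SigmaTau.BoundedApproximationProperty 𝕜 (StrongDual 𝕜 E) →
      ∃ Ψ : StrongDual 𝕜 (SigmaTau.SigmaNuclearOp 𝕜 p E F) ≃ₗᵢ[𝕜]
          SigmaTau.QuasiTauOp 𝕜 p (StrongDual 𝕜 E) F,
        ∀ (φ : StrongDual 𝕜 (SigmaTau.SigmaNuclearOp 𝕜 p E F)) (x' : StrongDual 𝕜 E) (y : F),
          (Ψ φ).toLin p x' y = φ (SigmaTau.SigmaNuclearOp.tensor p x' y)) :=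
  ⟨fun _ _ _ _ _ _ _ _ _ hE => SigmaTau.exists_borelEquiv p hE,
    fun _ _ _ _ _ _ _ _ hE => SigmaTau.exists_borelEquiv_op p hE⟩
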